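/- **Setting.** Let $R$ be a complete discrete valuation ring with fraction field $K$ and uniformizer $s$, and let $v_s:K^\times\to\mathbb Z$ be the valuation with $v_s(s)=1$. Let $X$ be a free $\mathbb Z$-module of finite rank $g$, $X^\vee=\mathrm{Hom}(X,\mathbb Z)$, $X_{\mathbb R}=X\otimes\mathbb R$, $X^\vee_{\mathbb R}=X^\vee\otimes\mathbb R$. An *FC datum* consists of a subgroup $Y\subset X$ of finite index, a function $a:Y\to K^\times$ with $a(0)=1$, and a bilinear $b:Y\times X\to K^\times$ with $b(y,z)=a(y+z)a(y)^{-1}a(z)^{-1}$ $(y,z\in Y)$, such that $B:=v_s\circ b$ is symmetric and positive definite on $Y\times Y$; it is *exact* if $a(y)=a(-y)$ for all $y$. Put $\beta:Y\to X^\vee$, $\beta(y)(x)=B(y,x)$, and $N=|X^\vee/\beta(Y)|$. An *extended FC datum* $\xi^e$ is an FC datum with a bilinear $b^e:X^\vee\times X\to K^\times$ such that $b(y,x)=b^e(\beta(y),x)$. A *Néron-FC datum* $\xi^\dagger$ relative to $\xi^e$ consists of $b^e,B,X,Y$, a homomorphism $\phi:X^\vee\to Y$ with $N\,u(x)=B(\phi(u),x)$,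 the function $\epsilon(u)=b^e(u,\phi(u))$, the function $E=v_s\circ\epsilon$, and the finite set $\Sigma=\{\alpha\in X: E(u)+u(\alpha)\ge 0\ \forall u\in X^\vee\}$, subject to $u(x)=v_sb^e(u,x)$, $E(u)=u(\phi(u))$ and $a(y)^{2N}=\epsilon(\beta(y))$ for all $u\in X^\vee$, $x\in X$, $y\in Y$. Let $\xi^e$ be an extended FC datum whose FC datum is exact, $\xi^\dagger$ a Néron-FC datum relative to $\xi^e$, and $l\ge 1$ an integer. Put $E_l=lE$, $\Sigma_l=\{\alpha\in X:E_l(u)+u(\alpha)\ge0\ \forall u\in X^\vee\}$, $\|z\|=\sqrt{B(z,z)}$ on $X_{\mathbb R}$, and, for $c\in X^\vee$, $$\Sigma_l(c)=\{x\in X_{\mathbb R}:\ \|x-2l\phi(u)\|\ge\|x-2l\phi(c)\|\ \ \forall u\in X^\vee\}.$$ Let $\mathrm{Vor}_l$ be the set of all $\Sigma_l(c)$ $(c\in X^\vee)$ and their non-empty faces. Assume that $\Sigma_l(0)$ is integral, i.e. $\Sigma_l(0)=\mathrm{Conv}(\Sigma_l(0)\cap X)$, $\Sigma_l(0)=-\Sigma_l(0)\ni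 0$, and $\Sigma_l(0)\cap X$ contains a basis of $X$. Define $D_l:X\to\mathbb Z$ by $D_l(x)=E_l(z)+z(\gamma)$ whenever $x=\gamma+2l\phi(z)$ with $\gamma\in\Sigma_l$, $z\in X^\vee$ (such $\gamma,z$ exist and the value does not depend on them). For $a\in X$ let $$\tau_{l,a}=\{x_0f_0+x\in\mathbb Rf_0\oplus X_{\mathbb R}^\vee:\ x_0\ge0,\ (D_l(y)-D_l(a))x_0+x(y-a)\ge0\ \ \forall y\in X\}.$$ Let $\mathrm{Fan}_l$ be the set of all cones $\tau_{l,\alpha+2l\phi(u)}$ $(\alpha\in\Sigma_l,\ u\in X^\vee)$ and their faces, and $\mathrm{Fan}_l^\times=\mathrm{Fan}_l\setminus\{(0)\}$. For a polytope $P$ let $\mathrm{Sk}^0(P)$ be its set of vertices. For $\Delta\in\mathrm{Vor}_l$ and $\tau\in\mathrm{Fan}_l^\times$ put $$\tau_{l,\Delta}=\bigcap_{a\in\mathrm{Sk}^0(\Delta)}\tau_{l,a},\qquad \mathrm{Cut}(\tau)=-f_0+\tau\cap(f_0+X^\vee_{\mathbb R}),\qquad \Delta(\tau)=\bigcap_{-v\in\mathrm{Sk}^0(\mathrm{Cut}(\tau))}\Sigma_l(v).$$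 **Proposition.** For every $\Delta\in\mathrm{Vor}_l$ one has $\mathrm{Sk}^0(\Delta)\subset X$ and $\tau_{l,\Delta}\in\mathrm{Fan}_l^\times$, and for every $\tau\in\mathrm{Fan}_l^\times$ one has $\mathrm{Sk}^0(\mathrm{Cut}(\tau))\subset X^\vee$, so that the above constructions make sense. Moreover: 1. $\Delta(\tau)\in\mathrm{Vor}_l$ and $\tau=\tau_{l,\Delta(\tau)}$ for every $\tau\in\mathrm{Fan}_l^\times$. 2. The map $\Delta\mapsto\mathrm{Cut}(\tau_{l,\Delta})$ is a bijection from $\mathrm{Vor}_l$ onto $\{\mathrm{Cut}(\tau):\tau\in\mathrm{Fan}_l^\times\}$, and for all $\sigma,\tau\in\mathrm{Fan}_l^\times$: (a) $\sigma\subset\tau\iff\mathrm{Cut}(\sigma)\subset\mathrm{Cut}(\tau)\iff\Delta(\sigma)\supset\Delta(\tau)$; (b) $\dim\mathrm{Cut}(\sigma)+\dim\Delta(\sigma)=g$. -/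

import Mathlib

open scoped TensorProduct

noncomputable section

namespace NeronFC

/-! ### Convex geometry in a real vector space -/

section Convex

variable {V : Type*} [AddCommGroup V] [Module ℝ V]

/-- `F` is a (non-empty, closed) face of the convex polytope `P`: the set of points of `P` at which
some linear functional attains its minimum over `P`. The functional `0` gives `P` itself. -/
def IsFace (P F : Set V) : Prop :=
  F.Nonempty ∧ ∃ f : Module.Dual ℝ V, F = {x | x ∈ P ∧ ∀ y ∈ P, f x ≤ f y}

/-- `Sk⁰(P)`: the points `v` such that `{v}` is a (zero-dimensional) face of `P`. -/
def vertices (P : Set V) : Set V := {v | IsFace P {v}}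

open Classical in
/-- The dimension of a convex set: the dimension of its affine span, with `dim ∅ = -1`. -/
def polyDim (P : Set V) : ℤ :=
  if P = ∅ then -1 else (Module.finrank ℝ (vectorSpan ℝ P) : ℤ)

end Convex

/-! ### The lattice `X`, its dual, and the associated real vector spaces -/

section Lattice

variable (X : Type*) [AddCommGroup X]

/-- `X_ℝ = X ⊗ ℝ`. -/
abbrev XR : Type _ := ℝ ⊗[ℤ] X

/-- `X^∨ = Hom_ℤ(X, ℤ)`. -/
abbrev XDual : Type _ := Module.Dual ℤ X

/-- `X^∨_ℝ`, identified (for `X` free of finite rank) with the real dual of `X_ℝ`, so that the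
natural pairing of `x ∈ X_ℝ` and `u ∈ X^∨_ℝ` is the evaluation `u x`. -/
abbrev XDualR : Type _ := Module.Dual ℝ (XR X)

variable {X}

/-- The inclusion `X → X_ℝ`. -/
def toXR (x : X) : XR X := (1 : ℝ) ⊗ₜ[ℤ] x

/-- The inclusion `X^∨ → X^∨_ℝ`, given by extension of scalars. -/
def toXDualR (u : XDual X) : XDualR X := Module.Dual.baseChange ℝ u

/-- A convex polytope `P` in `X_ℝ` is integral: `P = Conv(P ∩ X)`, `P = -P ∋ 0`, and
`P ∩ X` contains a `ℤ`-basis of `X`. -/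
structure IsIntegralPolytope (P : Set (XR X)) : Prop where
  eq_conv : P = convexHull ℝ (P ∩ Set.range (toXR (X := X)))
  neg_mem : ∀ x, x ∈ P ↔ -x ∈ P
  zero_mem : 0 ∈ P
  basis : ∃ m : Module.Basis (Fin (Module.finrank ℤ X)) ℤ X, ∀ i, toXR (m i) ∈ P

/-- `σ'` is a face of the cone `σ` in `X̃^∨_ℝ = ℝ f₀ ⊕ X^∨_ℝ`: there is `m = t m₀ + x` in the dual
cone `σ^∨ ⊆ X̃_ℝ = ℝ m₀ ⊕ X_ℝ` such that `σ' = σ ∩ m^⊥`. Here `z₀ f₀ + z` is the pair `(z₀, z)`,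
and its pairing with `t m₀ + x` is `z₀ t + z x`. -/
def IsConeFace (σ σ' : Set (ℝ × XDualR X)) : Prop :=
  ∃ (t : ℝ) (x : XR X), (∀ z ∈ σ, 0 ≤ z.1 * t + z.2 x) ∧ σ' = {z | z ∈ σ ∧ z.1 * t + z.2 x = 0}

/-- `Cut(σ) = -f₀ + σ ∩ (f₀ + X^∨_ℝ)`. -/
def Cut (σ : Set (ℝ × XDualR X)) : Set (XDualR X) := {z | ((1 : ℝ), z) ∈ σ}

end Lattice

/-! ### The valuation of a discrete valuation ring -/

/-- The valuation `v_s : k(η)^× → ℤ` of the fraction field `K = k(η)` of the discrete valuation ring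
`R`, normalized so that `v_s(s) = 1` for every uniformizer `s`, written as a homomorphism from the
(additively written) multiplicative group. Mathlib's valuation sends `s` to `exp (-1)`. -/
def vs (R K : Type*) [CommRing R] [IsDomain R] [IsDiscreteValuationRing R]
    [Field K] [Algebra R K] [IsFractionRing R K] : Additive Kˣ →+ ℤ where
  toFun c := -WithZero.log
    ((IsDiscreteValuationRing.maximalIdeal R).valuation K (c.toMul : K))
  map_zero' := by simp
  map_add' c d := by
    have hc : (IsDiscreteValuationRing.maximalIdeal R).valuation K (c.toMul : K) ≠ 0 := by simp
    have hd : (IsDiscreteValuationRing.maximalIdeal R).valuation K (d.toMul : K) ≠ 0 := by simp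
    rw [toMul_add, Units.val_mul, map_mul, WithZero.log_mul hc hd, neg_add]

/-! ### Faltings-Chai data -/

section Data

variable (R K X : Type*) [CommRing R] [IsDomain R] [IsDiscreteValuationRing R]
  [Field K] [Algebra R K] [IsFractionRing R K] [AddCommGroup X]

/-- A (totally degenerate) FC datum `ξ = (a, b, A, B, X, Y)` over `R`. The functions
`A = v_s ∘ a` and `B = v_s ∘ b` are derived from `a` and `b`, see `FCDatum.A` and `FCDatum.B`.
Bilinear functions with values in `K^×` are written with `K^×` as an additive group. -/
structure FCDatum where
  Y : Submodule ℤ X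
  finiteIndex : Y.toAddSubgroup.FiniteIndex
  a : Y → Kˣ
  b : Y →ₗ[ℤ] X →ₗ[ℤ] Additive Kˣ
  a_zero : a 0 = 1
  b_eq : ∀ y z : Y, (b y (z : X)).toMul = a (y + z) * (a y)⁻¹ * (a z)⁻¹
  symm : ∀ y z : Y, vs R K (b y (z : X)) = vs R K (b z (y : X))
  pos : ∀ y : Y, y ≠ 0 → 0 < vs R K (b y (y : X))

namespace FCDatum

variable {R K X} (ξ : FCDatum R K X)

/-- `A(y) = v_s a(y)`. -/
def A (y : ξ.Y) : ℤ := vs R K (Additive.ofMul (ξ.a y))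

/-- `B(y, x) = v_s b(y, x)`, a bilinear form on `Y × X`. The curried form is the homomorphism
`β : Y → X^∨`, `β(y)(x) = B(y, x)`. -/
def B : ξ.Y →ₗ[ℤ] X →ₗ[ℤ] ℤ := ξ.b.compr₂ (vs R K).toIntLinearMap

/-- `β : Y → X^∨`, `β(y)(x) = B(y, x)`. -/
def β : ξ.Y →ₗ[ℤ] XDual X := ξ.B

/-- `N = |X^∨ / β(Y)|`. -/
def N : ℕ := Nat.card (XDual X ⧸ LinearMap.range ξ.β)

/-- `ξ` is exact: `a(y) = a(-y)` for all `y ∈ Y`. -/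
def IsExact : Prop := ∀ y : ξ.Y, ξ.a y = ξ.a (-y)

/-- The index `[X : Y]`. -/
def idx : ℕ := ξ.Y.toAddSubgroup.index

/-- Multiplication by `[X : Y]`, as a map `X → Y`. -/
def mulIdx : X →ₗ[ℤ] ξ.Y :=
  LinearMap.codRestrict ξ.Y (ξ.idx • LinearMap.id) fun x => by
    simpa [idx] using ξ.Y.toAddSubgroup.nsmul_index_mem x

/-- The extension of `B` to a real bilinear form on `X_ℝ × X_ℝ = Y_ℝ × X_ℝ`: on `X × X` it is
`(x, x') ↦ [X : Y]⁻¹ B([X : Y] x, x')`. -/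
def BR : LinearMap.BilinForm ℝ (XR X) :=
  ((ξ.idx : ℝ)⁻¹) • LinearMap.BilinForm.baseChange ℝ (ξ.B ∘ₗ ξ.mulIdx : LinearMap.BilinForm ℤ X)

/-- The norm `‖z‖ = √B(z, z)` on `X_ℝ`. -/
def nrm (z : XR X) : ℝ := Real.sqrt (ξ.BR z z)

end FCDatum

/-- An extended FC datum `ξ^e = (a, b^e, A, B, X, Y)`: an FC datum together with a bilinear
`b^e : X^∨ × X → K^×` such that `b(y, x) = b^e(β(y), x)`. -/
structure ExtFCDatum extends FCDatum R K X where
  be : XDual X →ₗ[ℤ] X →ₗ[ℤ] Additive Kˣ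
  be_β : ∀ (y : toFCDatum.Y) (x : X), toFCDatum.b y x = be (toFCDatum.β y) x

variable {R K X}

/-- A Néron-FC datum `ξ^† = (ε, b^e, E, B, X, Y, φ, Σ)` relative to the extended FC datum `ξ^e`
(which provides `b^e`, `B`, `X`, `Y`). -/
structure NFCDatum (ξ : ExtFCDatum R K X) where
  ε : XDual X → Kˣ
  E : XDual X → ℤ
  φ : XDual X →ₗ[ℤ] ξ.Y
  Sig : Set X
  φ_eq : ∀ (u : XDual X) (x : X), (ξ.N : ℤ) * u x = ξ.B (φ u) x
  vs_be : ∀ (u : XDual X) (x : X), u x = vs R K (ξ.be u x)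
  ε_eq : ∀ u : XDual X, ε u = (ξ.be u (φ u : X)).toMul
  E_eq_vs : ∀ u : XDual X, E u = vs R K (Additive.ofMul (ε u))
  E_eq : ∀ u : XDual X, E u = u (φ u : X)
  a_pow : ∀ y : ξ.Y, ξ.a y ^ (2 * ξ.N) = ε (ξ.β y)
  Sig_finite : Sig.Finite
  Sig_eq : Sig = {α : X | ∀ u : XDual X, 0 ≤ E u + u α}

namespace NFCDatum

variable {ξ : ExtFCDatum R K X} (ζ : NFCDatum ξ) (l : ℕ)

/-- The lattice point `2lφ(u)` of `X`. -/
def shift (u : XDual X) : X := (2 * l) • (ζ.φ u : X)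

/-- `E_l = l E`. -/
def El (u : XDual X) : ℤ := l * ζ.E u

/-- `Σ_l = {α ∈ X | E_l(u) + u(α) ≥ 0 for all u ∈ X^∨}`. -/
def SigL : Set X := {α | ∀ u : XDual X, 0 ≤ ζ.El l u + u α}

/-- The Voronoi polytope `Σ_l(c)`, `c ∈ X^∨`. -/
def voronoi (c : XDual X) : Set (XR X) :=
  {x | ∀ u : XDual X,
    ξ.nrm (x - toXR (ζ.shift l c)) ≤ ξ.nrm (x - toXR (ζ.shift l u))}

/-- The Voronoi decomposition `Vor_l`: all `Σ_l(c)`, `c ∈ X^∨`, and their faces. -/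
def Vor : Set (Set (XR X)) := {Δ | ∃ c : XDual X, IsFace (ζ.voronoi l c) Δ}

open Classical in
/-- The function `D_l : X → ℤ`: `D_l(x) = E_l(z) + z(γ)` if `x = γ + 2lφ(z)` with `γ ∈ Σ_l` and
`z ∈ X^∨`. For `l > 0` every `x` has such a presentation, and the value does not depend on it. -/
def D (x : X) : ℤ :=
  if h : ∃ z : XDual X, x - ζ.shift l z ∈ ζ.SigL l then
    ζ.El l h.choose + h.choose (x - ζ.shift l h.choose)
  else 0

/-- The cone `τ_{l,a}` in `ℝ f₀ ⊕ X^∨_ℝ`, for `a ∈ X`. -/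
def tau (a : X) : Set (ℝ × XDualR X) :=
  {z | 0 ≤ z.1 ∧ ∀ y : X, 0 ≤ ((ζ.D l y - ζ.D l a : ℤ) : ℝ) * z.1 + z.2 (toXR (y - a))}

/-- The fan `Fan_l(ξ^†)`: the cones `τ_{l,α,u} = τ_{l,α + 2lφ(u)}`, `α ∈ Σ_l`, `u ∈ X^∨`, and
their faces. The zero cone is one of them. -/
def Fan : Set (Set (ℝ × XDualR X)) :=
  {σ | ∃ α ∈ ζ.SigL l, ∃ u : XDual X, IsConeFace (ζ.tau l (α + ζ.shift l u)) σ}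

/-- The non-zero cones of the fan. -/
def FanX : Set (Set (ℝ × XDualR X)) := ζ.Fan l \ {{0}}

/-- `τ_{l,Δ}`: the intersection of the `τ_{l,a}` over the vertices `a` of `Δ`. -/
def tauFace (Δ : Set (XR X)) : Set (ℝ × XDualR X) :=
  ⋂ (a : X) (_ : toXR a ∈ vertices Δ), ζ.tau l a

/-- `Δ(τ)`: the intersection of the `Σ_l(v)` over the `v ∈ X^∨` such that `-v` is a vertex of
`Cut(τ)`. -/
def deltaOf (τ : Set (ℝ × XDualR X)) : Set (XR X) :=
  ⋂ (v : XDual X) (_ : -toXDualR v ∈ vertices (Cut τ)), ζ.voronoi l v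

/-- The map `cut_l`, `Δ ↦ Cut(τ_{l,Δ})`. -/
def cut (Δ : Set (XR X)) : Set (XDualR X) := Cut (ζ.tauFace l Δ)

end NFCDatum

end Data

end NeronFC

end

/-!
The point is that everything is Legendre duality for one convex piecewise linear function.
Since `N u(x) = B(φ(u), x)`, completing the square gives
`‖x - 2lφ(u)‖² = ‖x‖² - 4lN (u(x) - E_l(u))` (`NFCDatum.BR_sub_shift_self`). Hence `Σ_l(c)` is the
region of `X_ℝ` where `c - E_l(c)` is the largest of the affine functions `u - E_l(u)`
(`NFCDatum.mem_voronoi`), and `D_l` is the restriction to `X` of their maximum `h`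
(`NFCDatum.D_eq`). On the other side `Cut(τ_{l,a})` is the negative of the subdifferential at `a`
of `D_l` (`NFCDatum.tau_eq`). The real extension of `B` is only needed to be positive semidefinite:
applied at `x ± m_i` for a basis `m_i`, this already shows that only finitely many of the affine
functions exceed a given bound at `x`.

Call `x ∈ X` and `u ∈ X^∨` incident if `x ∈ Σ_l(u)`. By integrality `Σ_l(u)` is the convex hull of
the `x` incident to `u`, and it follows, by separating a functional from a finite hull and
moving a little away from `a`, that the subdifferential at `a` is the convex hull of the `u` incident
to `a` (`PLTiling.dualCell_eq_convexHull`). Let `(A, B)` run over the pairs of non-empty sets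
that determine each other by incidence (`PLTiling.IsPair`). The faces of the Voronoi cells are the
sets `Conv(A)` (`PLTiling.isFace_cell_iff`), the faces of the subdifferentials are the sets `Conv(B)`
(`PLTiling.exists_isPair_of_dualCell_face`), and the two maps of the theorem exchange
`Conv(A)` with the cone over `-Conv(B)` (`NFCDatum.tauFace_eq`, `NFCDatum.deltaOf_eq`);
it suffices to intersect over vertices because a polytope is spanned by its vertices. Inclusions are
reversed because `A` and `B` determine each other. The dimensions add up because the directions of
`Conv(A)` are exactly those on which all differences of elements of `B` vanish
(`PLTiling.IsPair.finrank_vectorSpan_add`).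
-/

open scoped TensorProduct

noncomputable section

namespace NeronFC

/-! ### Faces and vertices of convex hulls -/

section Convex

variable {V : Type*} [AddCommGroup V] [Module ℝ V]

/-- A point of `Conv(S)` at which a linear functional attains a lower bound for its values on `S`
is a convex combination of points of `S` with the same property. -/
theorem mem_convexHull_of_eq_lowerBound {S : Set V} {f : Module.Dual ℝ V} {m : ℝ}
    (hm : ∀ s ∈ S, m ≤ f s) {x : V} (hx : x ∈ convexHull ℝ S) (hfx : f x = m) :
    x ∈ convexHull ℝ {s | s ∈ S ∧ f s = m} := by
  have hconv : Convex ℝ {x | m ≤ f x ∧ (f x = m → x ∈ convexHull ℝ {s | s ∈ S ∧ f s = m})} := by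
    rintro x ⟨hx, hx'⟩ y ⟨hy, hy'⟩ a b ha hb hab
    simp only [Set.mem_ofPred_eq, map_add, map_smul, smul_eq_mul]
    have hb' : b = 1 - a := by linarith
    refine ⟨by subst hb'; nlinarith, fun h => ?_⟩
    rcases ha.eq_or_lt with rfl | ha
    · obtain rfl : b = 1 := by linarith
      simpa using hy' (by linarith)
    rcases hb.eq_or_lt with rfl | hb
    · obtain rfl : a = 1 := by linarith
      simpa using hx' (by linarith)
    · have h1 : f x = m := by subst hb'; nlinarith
      have h2 : f y = m := by subst hb'; nlinarith
      exact convex_convexHull ℝ _ (hx' h1) (hy' h2) ha.le hb.le hab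
  have hsub : S ⊆ {x | m ≤ f x ∧ (f x = m → x ∈ convexHull ℝ {s | s ∈ S ∧ f s = m})} :=
    fun s hs => ⟨hm s hs, fun h => subset_convexHull ℝ _ ⟨hs, h⟩⟩
  exact (convexHull_min hsub hconv hx).2 hfx

theorem le_of_mem_convexHull {S : Set V} {f : Module.Dual ℝ V} {m : ℝ}
    (hm : ∀ s ∈ S, m ≤ f s) {x : V} (hx : x ∈ convexHull ℝ S) : m ≤ f x :=
  convexHull_min (t := {x | m ≤ f x}) hm (convex_halfSpace_ge f.isLinear m) hx

theorem eq_of_mem_convexHull {S : Set V} {f : Module.Dual ℝ V} {m : ℝ}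
    (hm : ∀ s ∈ S, f s = m) {x : V} (hx : x ∈ convexHull ℝ S) : f x = m :=
  convexHull_min (t := {x | f x = m}) hm (convex_hyperplane f.isLinear m) hx

/-- The face of `Conv(S)` cut out by a linear functional is spanned by the minimisers in `S`. -/
theorem setOf_isMin_convexHull (S : Set V) (f : Module.Dual ℝ V) :
    {x | x ∈ convexHull ℝ S ∧ ∀ y ∈ convexHull ℝ S, f x ≤ f y} =
      convexHull ℝ {s | s ∈ S ∧ ∀ y ∈ S, f s ≤ f y} := by
  apply Set.Subset.antisymm
  · rintro x ⟨hx, hmin⟩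
    have hm : ∀ s ∈ S, f x ≤ f s := fun s hs => hmin s (subset_convexHull ℝ _ hs)
    refine convexHull_mono ?_ (mem_convexHull_of_eq_lowerBound hm hx rfl)
    rintro s ⟨hs, hfs⟩
    exact ⟨hs, fun y hy => hfs ▸ hm y hy⟩
  · intro x hx
    obtain ⟨t, ht⟩ := convexHull_nonempty_iff.1 ⟨x, hx⟩
    refine ⟨convexHull_mono (fun s hs => hs.1) hx, fun y hy => ?_⟩
    rw [eq_of_mem_convexHull (m := f t) (fun s hs => le_antisymm (hs.2 t ht.1) (ht.2 s hs.1)) hx]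
    exact le_of_mem_convexHull ht.2 hy

theorem vertices_convexHull_subset (S : Set V) : vertices (convexHull ℝ S) ⊆ S := by
  rintro v ⟨-, f, hf⟩
  rw [setOf_isMin_convexHull] at hf
  have hne : {s | s ∈ S ∧ ∀ y ∈ S, f s ≤ f y}.Nonempty := by
    rw [← convexHull_nonempty_iff (𝕜 := ℝ), ← hf]
    exact Set.singleton_nonempty v
  obtain ⟨s, hs⟩ := hne
  have h : s ∈ ({v} : Set V) := hf ▸ subset_convexHull ℝ _ hs
  rw [Set.mem_singleton_iff] at h
  exact h ▸ hs.1

theorem vertices_subset (P : Set V) : vertices P ⊆ P := by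
  rintro v ⟨-, f, hf⟩
  have h : v ∈ ({v} : Set V) := rfl
  rw [hf] at h
  exact h.1

theorem exists_forall_lt_of_notMem_convexHull [FiniteDimensional ℝ V] {S : Set V} (hS : S.Finite)
    {v : V} (hv : v ∉ convexHull ℝ S) : ∃ f : Module.Dual ℝ V, ∀ s ∈ S, f v < f s := by
  -- `V` carries no topology; the Hahn-Banach theorem is applied in coordinates.
  let L := (Module.finBasis ℝ V).equivFun
  have hv' : L v ∉ convexHull ℝ (L '' S) := by
    rw [← LinearEquiv.coe_coe, ← LinearMap.image_convexHull, LinearEquiv.coe_coe]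
    rintro ⟨w, hw, hwv⟩
    exact hv (L.injective hwv ▸ hw)
  obtain ⟨f, u, h1, h2⟩ := geometric_hahn_banach_point_closed (convex_convexHull ℝ (L '' S))
    ((hS.image L).isCompact_convexHull ℝ).isClosed hv'
  refine ⟨f.toLinearMap ∘ₗ L.toLinearMap, fun s hs => ?_⟩
  exact h1.trans (h2 _ (subset_convexHull ℝ _ ⟨s, hs, rfl⟩))

/-- A polytope is the convex hull of its vertices. -/
theorem convexHull_vertices [FiniteDimensional ℝ V] {S : Set V} (hS : S.Finite) :
    convexHull ℝ (vertices (convexHull ℝ S)) = convexHull ℝ S := by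
  refine (convexHull_min (vertices_subset _) (convex_convexHull ℝ S)).antisymm ?_
  -- A minimal generating subset `W` of `S` consists of vertices.
  obtain ⟨W, -, hW⟩ := (hS.finite_subsets.subset
    (fun W (hW : W ∈ {W | W ⊆ S ∧ convexHull ℝ W = convexHull ℝ S}) => hW.1)).exists_le_minimal
    (a := S) ⟨subset_rfl, rfl⟩
  have hWfin : W.Finite := hS.subset hW.prop.1
  rw [← hW.prop.2]
  refine convexHull_mono fun v hv => ?_
  have hnot : v ∉ convexHull ℝ (W \ {v}) := by
    intro h
    have hsub : W ⊆ convexHull ℝ (W \ {v}) := by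
      intro w hw
      by_cases hwv : w = v
      · exact hwv ▸ h
      · exact subset_convexHull ℝ _ ⟨hw, hwv⟩
    have hmem := hW.le_of_le (y := W \ {v}) ⟨Set.sdiff_subset.trans hW.prop.1, ?_⟩ Set.sdiff_subset
    · exact (hmem hv).2 rfl
    · rw [← hW.prop.2]
      exact (convexHull_mono Set.sdiff_subset).antisymm
        (convexHull_min hsub (convex_convexHull ℝ _))
  obtain ⟨f, hf⟩ := exists_forall_lt_of_notMem_convexHull hWfin.sdiff hnot
  refine ⟨Set.singleton_nonempty v, f, ?_⟩
  rw [setOf_isMin_convexHull]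
  have : {s | s ∈ W ∧ ∀ y ∈ W, f s ≤ f y} = {v} := by
    ext s
    simp only [Set.mem_ofPred_eq, Set.mem_singleton_iff]
    constructor
    · rintro ⟨hs, hmin⟩
      by_contra hne
      exact absurd (hmin v hv) (not_le.2 (hf s ⟨hs, hne⟩))
    · rintro rfl
      refine ⟨hv, fun y hy => ?_⟩
      by_cases hys : y = s
      · rw [hys]
      · exact (hf y ⟨hy, hys⟩).le
  rw [this, convexHull_singleton]

theorem IsFace.neg {P F : Set V} (h : IsFace P F) : IsFace {x | -x ∈ P} {x | -x ∈ F} := by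
  obtain ⟨⟨w, hw⟩, f, rfl⟩ := h
  refine ⟨⟨-w, by simpa using hw⟩, -f, ?_⟩
  ext x
  simp only [Set.mem_ofPred_eq, LinearMap.neg_apply, map_neg]
  refine and_congr_right fun _ => ⟨fun h y hy => by simpa using h _ hy, fun h y hy => ?_⟩
  simpa using h (-y) (by simpa using hy)

theorem neg_mem_vertices_neg {P : Set V} {v : V} :
    -v ∈ vertices {x | -x ∈ P} ↔ v ∈ vertices P := by
  have key : ∀ (Q : Set V) (w : V), w ∈ vertices Q → -w ∈ vertices {x | -x ∈ Q} := by
    intro Q w hw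
    have h := IsFace.neg hw
    have hs : {x : V | -x ∈ ({w} : Set V)} = {-w} := by
      ext x
      simp [neg_eq_iff_eq_neg]
    rwa [hs] at h
  refine ⟨fun h => ?_, key P v⟩
  simpa using key _ _ h

/-- A finite family has a convex combination (its centroid) at which an affine inequality is an
equality only if it is one at every member. -/
theorem exists_mem_convexHull_forall_eq {S : Set V} (hS : S.Finite) (hne : S.Nonempty) :
    ∃ b ∈ convexHull ℝ S, ∀ (f : Module.Dual ℝ V) (m : ℝ), (∀ s ∈ S, m ≤ f s) → f b = m →
      ∀ s ∈ S, f s = m := by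
  lift S to Finset V using hS
  have hcard : (0 : ℝ) < S.card := by exact_mod_cast Finset.card_pos.2 (by exact_mod_cast hne)
  refine ⟨∑ s ∈ S, (S.card : ℝ)⁻¹ • s, ?_, fun f m hm hb s hs => ?_⟩
  · refine (convex_convexHull ℝ _).sum_mem (fun _ _ => by positivity) ?_
      fun s hs => subset_convexHull ℝ _ hs
    simp [hcard.ne']
  · have hsum : ∑ s ∈ S, (f s - m) = 0 := by
      simp only [map_sum, map_smul, smul_eq_mul, ← Finset.mul_sum] at hb
      rw [Finset.sum_sub_distrib, ← hb]
      simp only [Finset.sum_const, nsmul_eq_mul]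
      field_simp
      simp
    have := (Finset.sum_eq_zero_iff_of_nonneg fun s hs => sub_nonneg.2 (hm s hs)).1 hsum s hs
    linarith

end Convex

/-! ### Legendre duality for a tiling by integral cells -/

theorem exists_forall_le_of_finite_superlevel {U : Type*} (hU : Nonempty U) (f : U → ℝ)
    (hf : ∀ C, {u | C ≤ f u}.Finite) : ∃ u, ∀ u', f u' ≤ f u := by
  obtain ⟨u₀⟩ := hU
  obtain ⟨u, hu, hmax⟩ := Set.exists_max_image _ f (hf (f u₀)) ⟨u₀, le_refl (f u₀)⟩
  refine ⟨u, fun u' => ?_⟩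
  by_cases h : f u₀ ≤ f u'
  · exact hmax u' h
  · exact (not_le.1 h).le.trans hu

/-- A convex piecewise linear function on `V` together with its Legendre dual. The function is the
maximum of the affine functions `lin u - e u`, `u : U`; it takes the value `D x` at the marked point
`pt x`, `x : X`. The regions of linearity (`PLTiling.cell`) are required to be spanned by the marked
points in them. -/
structure PLTiling (V X U : Type*) [AddCommGroup V] [Module ℝ V] where
  pt : X → V
  lin : U → Module.Dual ℝ V
  D : X → ℝ
  e : U → ℝ
  lin_le : ∀ u x, lin u (pt x) ≤ D x + e u
  exists_lin : ∀ x, ∃ u, lin u (pt x) = D x + e u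
  exists_pt : ∀ u, ∃ x, lin u (pt x) = D x + e u
  subset_convexHull : ∀ u, {x | ∀ u', lin u' x - e u' ≤ lin u x - e u} ⊆
    convexHull ℝ (pt '' {x | lin u (pt x) = D x + e u})
  finite_pt : ∀ u, {x | lin u (pt x) = D x + e u}.Finite
  finite_lin : ∀ x C, {u | C ≤ lin u x - e u}.Finite

namespace PLTiling

variable {V X U : Type*} [AddCommGroup V] [Module ℝ V] (T : PLTiling V X U)

/-- Incidence: the affine function indexed by `u` is maximal at the marked point `x`. -/
def Inc (u : U) (x : X) : Prop := T.lin u (T.pt x) = T.D x + T.e u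

/-- The region where the affine function indexed by `u` is maximal. -/
def cell (u : U) : Set V := {x | ∀ u', T.lin u' x - T.e u' ≤ T.lin u x - T.e u}

/-- The subdifferential at the marked point `a` of the restriction of the function to the marked
points. -/
def dualCell (a : X) : Set (Module.Dual ℝ V) :=
  {z | ∀ y, z (T.pt y) - T.D y ≤ z (T.pt a) - T.D a}

/-- `A` and `B` are non-empty sets of marked points and of affine functions that determine each
other by incidence. These pairs index the faces of the cells and those of the dual cells. -/
structure IsPair (A : Set X) (B : Set U) : Prop where
  nonempty_left : A.Nonempty
  nonempty_right : B.Nonempty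
  mem_left : ∀ x, x ∈ A ↔ ∀ u ∈ B, T.Inc u x
  mem_right : ∀ u, u ∈ B ↔ ∀ x ∈ A, T.Inc u x

variable {T}

theorem pt_mem_cell {u : U} {x : X} : T.pt x ∈ T.cell u ↔ T.Inc u x := by
  refine ⟨fun h => ?_, fun h u' => ?_⟩
  · obtain ⟨u', hu'⟩ := T.exists_lin x
    exact le_antisymm (T.lin_le u x) (by linarith [h u'])
  · have h : T.lin u (T.pt x) = T.D x + T.e u := h
    linarith [T.lin_le u' x]

theorem lin_mem_dualCell {u : U} {x : X} : T.lin u ∈ T.dualCell x ↔ T.Inc u x := by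
  refine ⟨fun h => ?_, fun h y => ?_⟩
  · obtain ⟨y, hy⟩ := T.exists_pt u
    exact le_antisymm (T.lin_le u x) (by linarith [h y])
  · have h : T.lin u (T.pt x) = T.D x + T.e u := h
    linarith [T.lin_le u y]

theorem convex_cell (u : U) : Convex ℝ (T.cell u) := by
  intro x hx y hy a b ha hb hab u'
  simp only [map_add, map_smul, smul_eq_mul]
  have hb' : b = 1 - a := by linarith
  subst hb'
  nlinarith [mul_le_mul_of_nonneg_left (hx u') ha, mul_le_mul_of_nonneg_left (hy u') hb]

theorem convex_dualCell (x : X) : Convex ℝ (T.dualCell x) := by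
  intro z hz w hw a b ha hb hab y
  simp only [LinearMap.add_apply, LinearMap.smul_apply, smul_eq_mul]
  have hb' : b = 1 - a := by linarith
  subst hb'
  nlinarith [mul_le_mul_of_nonneg_left (hz y) ha, mul_le_mul_of_nonneg_left (hw y) hb]

theorem cell_eq_convexHull (u : U) : T.cell u = convexHull ℝ (T.pt '' {x | T.Inc u x}) := by
  refine (T.subset_convexHull u).antisymm (convexHull_min ?_ (convex_cell u))
  rintro _ ⟨x, hx, rfl⟩
  exact pt_mem_cell.2 hx

/-- On the intersection of two cells the two affine functions agree. -/
theorem eq_of_mem_cell {u u' : U} {x : V} (h : x ∈ T.cell u) (h' : x ∈ T.cell u') :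
    T.lin u x - T.e u = T.lin u' x - T.e u' := le_antisymm (h' u) (h u')

theorem mem_cell_of_eq {u u' : U} {x : V} (h : x ∈ T.cell u)
    (h' : T.lin u x - T.e u = T.lin u' x - T.e u') : x ∈ T.cell u' := fun w => h' ▸ h w

theorem finite_setOf_mem_cell (x : V) : {u | x ∈ T.cell u}.Finite := by
  rcases Set.eq_empty_or_nonempty {u | x ∈ T.cell u} with h | ⟨u, hu⟩
  · simp [h]
  · exact (T.finite_lin x (T.lin u x - T.e u)).subset fun u' hu' => hu' u

theorem finite_setOf_inc (x : X) : {u | T.Inc u x}.Finite :=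
  (finite_setOf_mem_cell (T.pt x)).subset fun _ h => pt_mem_cell.2 h

theorem exists_mem_cell (hU : Nonempty U) (x : V) : ∃ u, x ∈ T.cell u :=
  exists_forall_le_of_finite_superlevel hU _ (T.finite_lin x)

/-- An intersection of cells is spanned by the marked points in it. -/
theorem iInter_cell {B : Set U} (hB : B.Nonempty) :
    {x | ∀ u ∈ B, x ∈ T.cell u} = convexHull ℝ (T.pt '' {x | ∀ u ∈ B, T.Inc u x}) := by
  apply Set.Subset.antisymm
  · intro x hx
    obtain ⟨c, hc⟩ := hB
    have hfin : B.Finite := (finite_setOf_mem_cell x).subset hx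
    -- Each summand of this functional is bounded below on the cell of `c`, with equality
    -- on the cell of `u`.
    have key := mem_convexHull_of_eq_lowerBound (S := T.pt '' {x | T.Inc c x})
      (f := ∑ u ∈ hfin.toFinset, (T.lin c - T.lin u))
      (m := ∑ u ∈ hfin.toFinset, (T.e c - T.e u)) ?_ (x := x) ?_ ?_
    · refine convexHull_mono ?_ key
      rintro _ ⟨⟨y, hy, rfl⟩, hsum⟩
      refine ⟨y, fun u hu => ?_, rfl⟩
      simp only [LinearMap.sum_apply, LinearMap.sub_apply] at hsum
      have hterm : ∀ u ∈ hfin.toFinset,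
          T.e c - T.e u ≤ T.lin c (T.pt y) - T.lin u (T.pt y) := fun u _ => by
        linarith [(pt_mem_cell.2 hy) u]
      have h1 := (Finset.sum_eq_sum_iff_of_le hterm).1 hsum.symm u (hfin.mem_toFinset.2 hu)
      exact pt_mem_cell.1 (mem_cell_of_eq (pt_mem_cell.2 hy) (by linarith))
    · rintro _ ⟨y, hy, rfl⟩
      simp only [LinearMap.sum_apply, LinearMap.sub_apply]
      exact Finset.sum_le_sum fun u _ => by linarith [(pt_mem_cell.2 hy) u]
    · rw [← cell_eq_convexHull]
      exact hx c hc
    · simp only [LinearMap.sum_apply, LinearMap.sub_apply]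
      refine Finset.sum_congr rfl fun u hu => ?_
      linarith [eq_of_mem_cell (hx c hc) (hx u (hfin.mem_toFinset.1 hu))]
  · intro x hx u hu
    refine convexHull_min ?_ (convex_cell u) hx
    rintro _ ⟨y, hy, rfl⟩
    exact pt_mem_cell.2 (hy u hu)

/-- Moving a little from `b` in a direction `v` does not meet cells that do not contain `b`. The
cells met are those of the affine functions of largest slope along `v`. -/
theorem exists_small_step (b v : V) (hU : Nonempty U) : ∃ t : ℝ, 0 < t ∧
    ∀ u, b + t • v ∈ T.cell u ↔
      b ∈ T.cell u ∧ ∀ u', b ∈ T.cell u' → T.lin u' v ≤ T.lin u v := by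
  obtain ⟨u₀⟩ := hU
  -- An affine function that is maximal somewhere on the segment is at least the one of `u₀`
  -- at an end point.
  let S : Set U := {u | T.lin u₀ b - T.e u₀ ≤ T.lin u b - T.e u} ∪
    {u | T.lin u₀ (b + v) - T.e u₀ ≤ T.lin u (b + v) - T.e u}
  have hS : S.Finite := (T.finite_lin _ _).union (T.finite_lin _ _)
  have hmem : ∀ t : ℝ, 0 ≤ t → t ≤ 1 → ∀ u, b + t • v ∈ T.cell u → u ∈ S := by
    intro t h0 h1 u hu
    by_contra hnot
    simp only [S, Set.mem_union, Set.mem_ofPred_eq, not_or, not_le, map_add] at hnot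
    have h := hu u₀
    simp only [map_add, map_smul, smul_eq_mul] at h
    rcases h1.eq_or_lt with rfl | h1
    · linarith [hnot.2]
    · nlinarith [mul_pos (sub_pos.2 h1) (sub_pos.2 hnot.1),
        mul_nonneg h0 (sub_pos.2 hnot.2).le]
  have hev : ∀ᶠ t : ℝ in nhdsWithin 0 (Set.Ioi 0), ∀ u ∈ S, b + t • v ∈ T.cell u →
      b ∈ T.cell u := by
    rw [Filter.eventually_all_finite hS]
    intro u _
    by_cases hb : b ∈ T.cell u
    · exact Filter.Eventually.of_forall fun _ _ => hb
    · obtain ⟨u', hu'⟩ : ∃ u', T.lin u b - T.e u < T.lin u' b - T.e u' := by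
        by_contra hall
        push Not at hall
        exact hb hall
      have hcont : Continuous fun t : ℝ =>
          (T.lin u' b + t * T.lin u' v - T.e u') - (T.lin u b + t * T.lin u v - T.e u) := by
        fun_prop
      have hpos := (hcont.tendsto 0).eventually (lt_mem_nhds (a := 0) (by simpa using hu'))
      filter_upwards [nhdsWithin_le_nhds hpos] with t ht hcell
      have h := hcell u'
      simp only [map_add, map_smul, smul_eq_mul] at h
      linarith
  obtain ⟨t, ⟨ht, ht1⟩, ht0⟩ := ((hev.and (nhdsWithin_le_nhds (gt_mem_nhds (zero_lt_one' ℝ)))).and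
    self_mem_nhdsWithin).exists
  have ht0 : 0 < t := ht0
  have hsub : ∀ u, b + t • v ∈ T.cell u → b ∈ T.cell u :=
    fun u hu => ht u (hmem t ht0.le ht1.le u hu) hu
  refine ⟨t, ht0, fun u => ⟨fun hu => ⟨hsub u hu, fun u' hu' => ?_⟩, fun ⟨hu, hmax⟩ => ?_⟩⟩
  · have h := hu u'
    simp only [map_add, map_smul, smul_eq_mul] at h
    exact le_of_mul_le_mul_left (by linarith [eq_of_mem_cell (hsub u hu) hu']) ht0
  · obtain ⟨u₁, h₁⟩ := exists_mem_cell (T := T) ⟨u₀⟩ (b + t • v)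
    intro w
    have hw := h₁ w
    simp only [map_add, map_smul, smul_eq_mul] at hw ⊢
    linarith [eq_of_mem_cell (hsub u₁ h₁) hu, mul_le_mul_of_nonneg_left (hmax u₁ (hsub u₁ h₁)) ht0.le]

namespace IsPair

variable {A A' : Set X} {B B' : Set U}

theorem finite_left (h : T.IsPair A B) : A.Finite := by
  obtain ⟨u, hu⟩ := h.nonempty_right
  exact (T.finite_pt u).subset fun x hx => (h.mem_left x).1 hx u hu

theorem finite_right (h : T.IsPair A B) : B.Finite := by
  obtain ⟨x, hx⟩ := h.nonempty_left
  exact (finite_setOf_inc x).subset fun u hu => (h.mem_right u).1 hu x hx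

theorem inc (h : T.IsPair A B) {x : X} {u : U} (hx : x ∈ A) (hu : u ∈ B) : T.Inc u x :=
  (h.mem_left x).1 hx u hu

theorem convexHull_left (h : T.IsPair A B) :
    convexHull ℝ (T.pt '' A) = {x | ∀ u ∈ B, x ∈ T.cell u} := by
  rw [iInter_cell h.nonempty_right]
  congr 2
  ext x
  exact h.mem_left x

theorem pt_mem_convexHull (h : T.IsPair A B) {x : X} :
    T.pt x ∈ convexHull ℝ (T.pt '' A) ↔ x ∈ A := by
  rw [h.convexHull_left, h.mem_left]
  exact forall₂_congr fun u _ => pt_mem_cell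

theorem subset_iff (h : T.IsPair A B) (h' : T.IsPair A' B') : B ⊆ B' ↔ A' ⊆ A :=
  ⟨fun hB x hx => (h.mem_left x).2 fun _ hu => h'.inc hx (hB hu),
    fun hA u hu => (h'.mem_right u).2 fun _ hx => h.inc (hA hx) hu⟩

theorem convexHull_left_subset_iff (h : T.IsPair A B) (h' : T.IsPair A' B') :
    convexHull ℝ (T.pt '' A) ⊆ convexHull ℝ (T.pt '' A') ↔ A ⊆ A' := by
  refine ⟨fun hsub x hx => ?_, fun hsub => convexHull_mono (Set.image_mono hsub)⟩
  exact h'.pt_mem_convexHull.1 (hsub (h.pt_mem_convexHull.2 hx))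

end IsPair

/-- The cells through a point of `V`, with the marked points in their intersection. -/
theorem isPair_of_mem_cell {b : V} (hb : ∃ u, b ∈ T.cell u) :
    T.IsPair {x | ∀ u, b ∈ T.cell u → T.Inc u x} {u | b ∈ T.cell u} := by
  have hmem : b ∈ convexHull ℝ (T.pt '' {x | ∀ u, b ∈ T.cell u → T.Inc u x}) := by
    have h := iInter_cell (T := T) (B := {u | b ∈ T.cell u}) hb
    exact h ▸ fun u hu => hu
  refine ⟨?_, hb, fun x => Iff.rfl, fun u => ⟨fun hu x hx => hx u hu, fun hu => ?_⟩⟩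
  · exact Set.image_nonempty.1 (convexHull_nonempty_iff.1 ⟨b, hmem⟩)
  · refine convexHull_min ?_ (convex_cell u) hmem
    rintro _ ⟨x, hx, rfl⟩
    exact pt_mem_cell.2 (hu x hx)

/-- The convex hull of a non-empty set of marked points of one cell has a point that lies in no cell
other than those containing the whole set. -/
theorem exists_carrier {A : Set X} (hne : A.Nonempty) {c : U} (hA : ∀ x ∈ A, T.Inc c x) :
    ∃ b ∈ convexHull ℝ (T.pt '' A), ∀ u, b ∈ T.cell u ↔ ∀ x ∈ A, T.Inc u x := by
  have hfin : A.Finite := (T.finite_pt c).subset hA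
  obtain ⟨b, hb, hext⟩ := exists_mem_convexHull_forall_eq (hfin.image T.pt) (hne.image T.pt)
  have hsub : ∀ u, (∀ x ∈ A, T.Inc u x) → b ∈ T.cell u := by
    intro u hu
    refine convexHull_min ?_ (convex_cell u) hb
    rintro _ ⟨x, hx, rfl⟩
    exact pt_mem_cell.2 (hu x hx)
  refine ⟨b, hb, fun u => ⟨fun hu x hx => ?_, hsub u⟩⟩
  have hbc := eq_of_mem_cell (hsub c hA) hu
  have h := hext (T.lin c - T.lin u) (T.e c - T.e u) ?_ ?_ (T.pt x) ⟨x, hx, rfl⟩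
  · rw [LinearMap.sub_apply] at h
    exact pt_mem_cell.1 (mem_cell_of_eq (pt_mem_cell.2 (hA x hx)) (by linarith))
  · rintro _ ⟨y, hy, rfl⟩
    rw [LinearMap.sub_apply]
    linarith [(pt_mem_cell.2 (hA y hy)) u]
  · rw [LinearMap.sub_apply]
    linarith

/-- The faces of the cells are the convex hulls of the left members of pairs. -/
theorem isFace_cell_iff {F : Set V} :
    (∃ c, IsFace (T.cell c) F) ↔ ∃ A B, T.IsPair A B ∧ F = convexHull ℝ (T.pt '' A) := by
  constructor
  · rintro ⟨c, hne, f, rfl⟩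
    rw [cell_eq_convexHull, setOf_isMin_convexHull] at hne ⊢
    set A : Set X := {x | T.Inc c x ∧ ∀ y, T.Inc c y → f (T.pt x) ≤ f (T.pt y)} with hAdef
    have hA : {s | s ∈ T.pt '' {x | T.Inc c x} ∧ ∀ y ∈ T.pt '' {x | T.Inc c x}, f s ≤ f y} =
        T.pt '' A := by
      ext s
      constructor
      · rintro ⟨⟨x, hx, rfl⟩, hmin⟩
        exact ⟨x, ⟨hx, fun y hy => hmin _ ⟨y, hy, rfl⟩⟩, rfl⟩
      · rintro ⟨x, ⟨hx, hmin⟩, rfl⟩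
        refine ⟨⟨x, hx, rfl⟩, ?_⟩
        rintro _ ⟨y, hy, rfl⟩
        exact hmin y hy
    rw [hA] at hne ⊢
    have hne : A.Nonempty := Set.image_nonempty.1 (convexHull_nonempty_iff.1 hne)
    obtain ⟨b, hb, hbcell⟩ := exists_carrier hne (c := c) fun x hx => hx.1
    refine ⟨A, {u | ∀ x ∈ A, T.Inc u x}, ⟨hne, ⟨c, fun x hx => hx.1⟩, fun x =>
      ⟨fun hx u hu => hu x hx, fun hx => ?_⟩, fun u => Iff.rfl⟩, rfl⟩
    have hxc : T.Inc c x := hx c fun y hy => hy.1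
    -- Move from the point `b` in the direction away from `x`; the point reached is still in the
    -- cell of `c`, because the affine functions maximal at `b` have the same slope along `b - x`.
    obtain ⟨t, ht, hstep⟩ := exists_small_step (T := T) b (b - T.pt x) ⟨c⟩
    have hmemc : b + t • (b - T.pt x) ∈ T.cell c := by
      refine (hstep c).2 ⟨(hbcell c).2 fun y hy => hy.1, fun u hu => ?_⟩
      have h1 := eq_of_mem_cell hu ((hbcell c).2 fun y hy => hy.1)
      have h2 : T.lin u (T.pt x) = T.D x + T.e u := hx u ((hbcell u).1 hu)
      have h3 : T.lin c (T.pt x) = T.D x + T.e c := hxc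
      simp only [map_sub]
      linarith
    refine ⟨hxc, fun y hy => ?_⟩
    obtain ⟨a, ha⟩ := hne
    have hfb : f b = f (T.pt a) := by
      refine eq_of_mem_convexHull ?_ hb
      rintro _ ⟨a', ha', rfl⟩
      exact le_antisymm (ha'.2 a ha.1) (ha.2 a' ha'.1)
    rw [cell_eq_convexHull] at hmemc
    have hlow := le_of_mem_convexHull (f := f) (m := f (T.pt a)) ?_ hmemc
    · simp only [map_add, map_smul, map_sub, smul_eq_mul, hfb] at hlow
      have : 0 ≤ f (T.pt a) - f (T.pt x) := nonneg_of_mul_nonneg_right (by linarith) ht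
      linarith [ha.2 y hy]
    · rintro _ ⟨a', ha', rfl⟩
      exact ha.2 a' ha'
  · rintro ⟨A, B, h, rfl⟩
    obtain ⟨c, hc⟩ := h.nonempty_right
    refine ⟨c, (h.nonempty_left.image _).convexHull, ∑ u ∈ h.finite_right.toFinset,
      (T.lin c - T.lin u), ?_⟩
    rw [h.convexHull_left]
    simp only [LinearMap.sum_apply, LinearMap.sub_apply]
    have hterm : ∀ x ∈ T.cell c, ∀ u ∈ h.finite_right.toFinset,
        T.e c - T.e u ≤ T.lin c x - T.lin u x := fun x hx u _ => by linarith [hx u]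
    ext x
    constructor
    · intro hx
      refine ⟨hx c hc, fun y hy => le_trans (Finset.sum_le_sum fun u hu => ?_)
        (Finset.sum_le_sum (hterm y hy))⟩
      linarith [eq_of_mem_cell (hx c hc) (hx u (h.finite_right.mem_toFinset.1 hu))]
    · rintro ⟨hx, hmin⟩ u hu
      obtain ⟨a, ha⟩ := h.nonempty_left
      have ha' : ∀ u ∈ B, T.pt a ∈ T.cell u := fun u hu => pt_mem_cell.2 (h.inc ha hu)
      have hle : ∑ u ∈ h.finite_right.toFinset, (T.lin c x - T.lin u x) ≤
          ∑ u ∈ h.finite_right.toFinset, (T.e c - T.e u) := by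
        refine (hmin _ (ha' c hc)).trans (Finset.sum_le_sum fun u hu => ?_)
        linarith [eq_of_mem_cell (ha' c hc) (ha' u (h.finite_right.mem_toFinset.1 hu))]
      have heq := (Finset.sum_eq_sum_iff_of_le (hterm x hx)).1
        (le_antisymm (Finset.sum_le_sum (hterm x hx)) hle) u (h.finite_right.mem_toFinset.2 hu)
      exact mem_cell_of_eq hx (by linarith)

variable [FiniteDimensional ℝ V]

/-- The dual cell of `a` is spanned by the affine functions maximal at `a`: a functional outside
their convex hull is separated from it by a direction `v`, and along `-v` the piecewise linear
function grows too slowly near `a` for that functional to be a subgradient. -/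
theorem dualCell_eq_convexHull (a : X) :
    T.dualCell a = convexHull ℝ (T.lin '' {u | T.Inc u a}) := by
  refine Set.Subset.antisymm (fun z hz => ?_) (convexHull_min ?_ (convex_dualCell a))
  · by_contra hnot
    obtain ⟨F, hF⟩ := exists_forall_lt_of_notMem_convexHull ((finite_setOf_inc a).image T.lin) hnot
    obtain ⟨v, rfl⟩ := (Module.evalEquiv ℝ V).surjective F
    obtain ⟨c, hc⟩ := T.exists_lin a
    obtain ⟨t, ht, hstep⟩ := exists_small_step (T := T) (T.pt a) (-v) ⟨c⟩
    obtain ⟨u, hu⟩ := exists_mem_cell (T := T) ⟨c⟩ (T.pt a + t • -v)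
    have hua : T.Inc u a := pt_mem_cell.1 ((hstep u).1 hu).1
    have hlt : z v < T.lin u v := by simpa using hF _ ⟨u, hua, rfl⟩
    rw [cell_eq_convexHull] at hu
    have hlow := le_of_mem_convexHull (f := T.lin u - z) (m := (T.lin u - z) (T.pt a)) ?_ hu
    · simp only [map_add, map_smul, map_neg, LinearMap.sub_apply, smul_eq_mul] at hlow
      nlinarith [mul_pos ht (sub_pos.2 hlt)]
    · rintro _ ⟨y, hy, rfl⟩
      have h1 : T.lin u (T.pt y) = T.D y + T.e u := hy
      have h2 : T.lin u (T.pt a) = T.D a + T.e u := hua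
      simp only [LinearMap.sub_apply]
      linarith [hz y]
  · rintro _ ⟨u, hu, rfl⟩
    exact lin_mem_dualCell.2 hu

/-- An intersection of dual cells is spanned by the affine functions in it. -/
theorem iInter_dualCell {A : Set X} (hfin : A.Finite) (hne : A.Nonempty) :
    {z | ∀ x ∈ A, z ∈ T.dualCell x} = convexHull ℝ (T.lin '' {u | ∀ x ∈ A, T.Inc u x}) := by
  symm
  apply Set.Subset.antisymm
  · intro z hz x hx
    suffices hsub : convexHull ℝ (T.lin '' {u | ∀ x ∈ A, T.Inc u x}) ⊆ T.dualCell x from hsub hz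
    refine convexHull_min ?_ (convex_dualCell x)
    rintro _ ⟨u, hu, rfl⟩
    exact lin_mem_dualCell.2 (hu x hx)
  · intro z hz
    obtain ⟨a, ha⟩ := hne
    have key := mem_convexHull_of_eq_lowerBound (S := T.lin '' {u | T.Inc u a})
      (f := ∑ x ∈ hfin.toFinset, Module.Dual.eval ℝ V (T.pt a - T.pt x))
      (m := ∑ x ∈ hfin.toFinset, (T.D a - T.D x)) ?_ (x := z) ?_ ?_
    · refine convexHull_mono ?_ key
      rintro _ ⟨⟨u, hu, rfl⟩, hsum⟩
      refine ⟨u, fun x hx => ?_, rfl⟩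
      simp only [LinearMap.sum_apply, map_sub, LinearMap.sub_apply, Module.Dual.eval_apply] at hsum
      have hu' : T.lin u (T.pt a) = T.D a + T.e u := hu
      have hterm : ∀ x ∈ hfin.toFinset,
          T.D a - T.D x ≤ T.lin u (T.pt a) - T.lin u (T.pt x) := fun x _ => by
        linarith [T.lin_le u x]
      have h1 := (Finset.sum_eq_sum_iff_of_le hterm).1 hsum.symm x (hfin.mem_toFinset.2 hx)
      change T.lin u (T.pt x) = T.D x + T.e u
      linarith
    · rintro _ ⟨u, hu, rfl⟩
      have hu' : T.lin u (T.pt a) = T.D a + T.e u := hu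
      simp only [LinearMap.sum_apply, map_sub, LinearMap.sub_apply, Module.Dual.eval_apply]
      exact Finset.sum_le_sum fun x _ => by linarith [T.lin_le u x]
    · rw [← dualCell_eq_convexHull]
      exact hz a ha
    · simp only [LinearMap.sum_apply, map_sub, LinearMap.sub_apply, Module.Dual.eval_apply]
      refine Finset.sum_congr rfl fun x hx => ?_
      linarith [hz a ha x, hz x (hfin.mem_toFinset.1 hx) a]

namespace IsPair

variable {A A' : Set X} {B B' : Set U}

theorem convexHull_right (h : T.IsPair A B) :
    convexHull ℝ (T.lin '' B) = {z | ∀ x ∈ A, z ∈ T.dualCell x} := by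
  rw [iInter_dualCell h.finite_left h.nonempty_left]
  congr 2
  ext u
  exact h.mem_right u

theorem lin_mem_convexHull (h : T.IsPair A B) {u : U} :
    T.lin u ∈ convexHull ℝ (T.lin '' B) ↔ u ∈ B := by
  rw [h.convexHull_right, h.mem_right]
  exact forall₂_congr fun x _ => lin_mem_dualCell

theorem convexHull_right_subset_iff (h : T.IsPair A B) (h' : T.IsPair A' B') :
    convexHull ℝ (T.lin '' B) ⊆ convexHull ℝ (T.lin '' B') ↔ B ⊆ B' := by
  refine ⟨fun hsub x hx => ?_, fun hsub => convexHull_mono (Set.image_mono hsub)⟩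
  exact h'.lin_mem_convexHull.1 (hsub (h.lin_mem_convexHull.2 hx))

/-- The vertices of the face of `A` have the same affine functions maximal at them as `A`. -/
theorem mem_right_iff_vertices (h : T.IsPair A B) (u : U) :
    u ∈ B ↔ ∀ x, T.pt x ∈ vertices (convexHull ℝ (T.pt '' A)) → T.Inc u x := by
  refine ⟨fun hu x hx => h.inc (h.pt_mem_convexHull.1 (vertices_subset _ hx)) hu, fun hu => ?_⟩
  refine (h.mem_right u).2 fun x hx => pt_mem_cell.1 ?_
  have hx' : T.pt x ∈ convexHull ℝ (vertices (convexHull ℝ (T.pt '' A))) := by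
    rw [convexHull_vertices (h.finite_left.image _)]
    exact h.pt_mem_convexHull.2 hx
  refine convexHull_min (fun v hv => ?_) (convex_cell u) hx'
  obtain ⟨y, -, rfl⟩ := vertices_convexHull_subset _ hv
  exact pt_mem_cell.2 (hu y hv)

theorem mem_left_iff_vertices (h : T.IsPair A B) (x : X) :
    x ∈ A ↔ ∀ u, T.lin u ∈ vertices (convexHull ℝ (T.lin '' B)) → T.Inc u x := by
  refine ⟨fun hx u hu => h.inc hx (h.lin_mem_convexHull.1 (vertices_subset _ hu)), fun hx => ?_⟩
  refine (h.mem_left x).2 fun u hu => lin_mem_dualCell.1 ?_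
  have hu' : T.lin u ∈ convexHull ℝ (vertices (convexHull ℝ (T.lin '' B))) := by
    rw [convexHull_vertices (h.finite_right.image _)]
    exact h.lin_mem_convexHull.2 hu
  suffices hsub : convexHull ℝ (vertices (convexHull ℝ (T.lin '' B))) ⊆ T.dualCell x from hsub hu'
  refine convexHull_min (fun v hv => ?_) (convex_dualCell x)
  obtain ⟨w, -, rfl⟩ := vertices_convexHull_subset _ hv
  exact lin_mem_dualCell.2 (hx w hv)

theorem exists_vertex_right (h : T.IsPair A B) :
    ∃ u, T.lin u ∈ vertices (convexHull ℝ (T.lin '' B)) := by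
  have hne : (convexHull ℝ (T.lin '' B)).Nonempty := (h.nonempty_right.image _).convexHull
  rw [← convexHull_vertices (h.finite_right.image _), convexHull_nonempty_iff] at hne
  obtain ⟨v, hv⟩ := hne
  obtain ⟨u, -, rfl⟩ := vertices_convexHull_subset _ hv
  exact ⟨u, hv⟩

theorem exists_vertex_left (h : T.IsPair A B) :
    ∃ x, T.pt x ∈ vertices (convexHull ℝ (T.pt '' A)) := by
  have hne : (convexHull ℝ (T.pt '' A)).Nonempty := (h.nonempty_left.image _).convexHull
  rw [← convexHull_vertices (h.finite_left.image _), convexHull_nonempty_iff] at hne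
  obtain ⟨v, hv⟩ := hne
  obtain ⟨x, -, rfl⟩ := vertices_convexHull_subset _ hv
  exact ⟨x, hv⟩

theorem iInter_dualCell_vertices (h : T.IsPair A B) :
    {z | ∀ x, T.pt x ∈ vertices (convexHull ℝ (T.pt '' A)) → z ∈ T.dualCell x} =
      convexHull ℝ (T.lin '' B) := by
  obtain ⟨x, hx⟩ := h.exists_vertex_left
  have h1 := iInter_dualCell (T := T) (A := {x | T.pt x ∈ vertices (convexHull ℝ (T.pt '' A))})
    (h.finite_left.subset fun x hx => h.pt_mem_convexHull.1 (vertices_subset _ hx)) ⟨x, hx⟩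
  refine h1.trans ?_
  congr 2
  ext u
  exact (h.mem_right_iff_vertices u).symm

theorem iInter_cell_vertices (h : T.IsPair A B) :
    {x | ∀ u, T.lin u ∈ vertices (convexHull ℝ (T.lin '' B)) → x ∈ T.cell u} =
      convexHull ℝ (T.pt '' A) := by
  obtain ⟨u, hu⟩ := h.exists_vertex_right
  have h1 := iInter_cell (T := T) (B := {u | T.lin u ∈ vertices (convexHull ℝ (T.lin '' B))})
    ⟨u, hu⟩
  refine h1.trans ?_
  congr 2
  ext x
  exact (h.mem_left_iff_vertices x).symm

/-- The directions of the face of `A` are those along which all functionals in `B` agree: from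
a point in no other cells, a small step in such a direction stays in all the cells of `B`. -/
theorem finrank_vectorSpan_add (h : T.IsPair A B) :
    Module.finrank ℝ (vectorSpan ℝ (convexHull ℝ (T.lin '' B))) +
      Module.finrank ℝ (vectorSpan ℝ (convexHull ℝ (T.pt '' A))) = Module.finrank ℝ V := by
  set W := vectorSpan ℝ (convexHull ℝ (T.lin '' B)) with hW
  have key : vectorSpan ℝ (convexHull ℝ (T.pt '' A)) = W.dualCoannihilator := by
    apply le_antisymm
    · rw [vectorSpan_def, Submodule.span_le]
      rintro _ ⟨x, hx, y, hy, rfl⟩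
      rw [SetLike.mem_coe, Submodule.mem_dualCoannihilator]
      have hx' := h.convexHull_left ▸ hx
      have hy' := h.convexHull_left ▸ hy
      suffices hle : W ≤ LinearMap.ker (Module.Dual.eval ℝ V (x - y)) from
        fun φ hφ => hle hφ
      obtain ⟨u, hu⟩ := h.nonempty_right
      rw [hW, ← direction_affineSpan, affineSpan_convexHull, direction_affineSpan,
        vectorSpan_eq_span_vsub_set_right ℝ (Set.mem_image_of_mem T.lin hu), Submodule.span_le]
      rintro _ ⟨_, ⟨u', hu', rfl⟩, rfl⟩
      simp only [vsub_eq_sub, SetLike.mem_coe, LinearMap.mem_ker, Module.Dual.eval_apply,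
        LinearMap.sub_apply, map_sub]
      linarith [eq_of_mem_cell (hx' u hu) (hx' u' hu'), eq_of_mem_cell (hy' u hu) (hy' u' hu')]
    · intro v hv
      rw [Submodule.mem_dualCoannihilator] at hv
      obtain ⟨c, hc⟩ := h.nonempty_right
      obtain ⟨b, hb, hbcell⟩ := exists_carrier h.nonempty_left fun x hx => h.inc hx hc
      obtain ⟨t, ht, hstep⟩ := exists_small_step (T := T) b v ⟨c⟩
      have hmem : b + t • v ∈ convexHull ℝ (T.pt '' A) := by
        rw [h.convexHull_left]
        intro u hu
        refine (hstep u).2 ⟨(hbcell u).2 ((h.mem_right u).1 hu), fun u' hu' => ?_⟩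
        have hu'B : u' ∈ B := (h.mem_right u').2 ((hbcell u').1 hu')
        have h0 := hv (T.lin u' - T.lin u) (vsub_mem_vectorSpan ℝ
          (h.lin_mem_convexHull.2 hu'B) (h.lin_mem_convexHull.2 hu))
        rw [LinearMap.sub_apply] at h0
        linarith
      have h1 := vsub_mem_vectorSpan ℝ hmem hb
      rw [vsub_eq_sub, add_sub_cancel_left] at h1
      exact (Submodule.smul_mem_iff _ ht.ne').1 h1
  rw [key]
  exact Subspace.finrank_add_finrank_dualCoannihilator_eq W

end IsPair

/-- The face of the dual cell of `a` on which the direction `v` is maximal consists of the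
functionals maximal at a point `a + t v` for small `t`. -/
theorem exists_isPair_of_dualCell_face (a : X) (v : V) (m : ℝ) (hm : ∀ z ∈ T.dualCell a, z v ≤ m)
    (hne : ∃ z ∈ T.dualCell a, z v = m) :
    ∃ A B, T.IsPair A B ∧ a ∈ A ∧ {z | z ∈ T.dualCell a ∧ z v = m} = convexHull ℝ (T.lin '' B) := by
  obtain ⟨c, hc⟩ := T.exists_lin a
  obtain ⟨t, ht, hstep⟩ := exists_small_step (T := T) (T.pt a) v ⟨c⟩
  have hsub : {z | z ∈ T.dualCell a ∧ z v = m} ⊆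
      convexHull ℝ (T.lin '' {u | T.Inc u a ∧ T.lin u v = m}) := by
    rintro z ⟨hz, hzm⟩
    have key := mem_convexHull_of_eq_lowerBound (S := T.lin '' {u | T.Inc u a})
      (f := Module.Dual.eval ℝ V (-v)) (m := -m) ?_ (x := z) ?_ ?_
    · refine convexHull_mono ?_ key
      rintro _ ⟨⟨u, hu, rfl⟩, huv⟩
      exact ⟨u, ⟨hu, by simpa using huv⟩, rfl⟩
    · rintro _ ⟨u, hu, rfl⟩
      simpa using hm _ (lin_mem_dualCell.2 hu)
    · rwa [← dualCell_eq_convexHull]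
    · simpa using hzm
  obtain ⟨z₀, hz₀⟩ := hne
  obtain ⟨u₀, hu₀, hu₀m⟩ : {u | T.Inc u a ∧ T.lin u v = m}.Nonempty :=
    Set.image_nonempty.1 (convexHull_nonempty_iff.1 ⟨z₀, hsub hz₀⟩)
  have hcell : ∀ u, T.pt a + t • v ∈ T.cell u ↔ T.Inc u a ∧ T.lin u v = m := by
    intro u
    rw [hstep u, pt_mem_cell]
    refine and_congr_right fun hu => ⟨fun h => le_antisymm (hm _ (lin_mem_dualCell.2 hu)) ?_,
      fun h u' hu' => h ▸ hm _ (lin_mem_dualCell.2 (pt_mem_cell.1 hu'))⟩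
    exact hu₀m ▸ h u₀ (pt_mem_cell.2 hu₀)
  refine ⟨_, _, isPair_of_mem_cell ⟨u₀, (hcell u₀).2 ⟨hu₀, hu₀m⟩⟩,
    fun u hu => ((hcell u).1 hu).1, ?_⟩
  have hB : {u | T.pt a + t • v ∈ T.cell u} = {u | T.Inc u a ∧ T.lin u v = m} := by
    ext u
    exact hcell u
  rw [hB]
  refine hsub.antisymm fun z hz => ⟨?_, ?_⟩
  · rw [dualCell_eq_convexHull]
    exact convexHull_mono (Set.image_mono fun u hu => hu.1) hz
  · have := eq_of_mem_convexHull (f := Module.Dual.eval ℝ V v) (m := m) ?_ hz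
    · simpa using this
    · rintro _ ⟨u, hu, rfl⟩
      simpa using hu.2

end PLTiling

/-! ### The lattice and the real bilinear form -/

section Lattice

variable {X : Type*} [AddCommGroup X]

theorem toXR_add (x y : X) : toXR (x + y) = toXR x + toXR y := TensorProduct.tmul_add _ _ _

theorem toXR_sub (x y : X) : toXR (x - y) = toXR x - toXR y := TensorProduct.tmul_sub _ _ _

theorem toXR_zsmul (n : ℤ) (x : X) : toXR (n • x) = (n : ℝ) • toXR x := by
  simp [toXR, TensorProduct.smul_tmul']

theorem toXR_nsmul (n : ℕ) (x : X) : toXR (n • x) = (n : ℝ) • toXR x := by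
  rw [← natCast_zsmul, toXR_zsmul, Int.cast_natCast]

@[simp]
theorem toXDualR_toXR (u : XDual X) (x : X) : toXDualR u (toXR x) = (u x : ℝ) := by
  simp [toXDualR, toXR]

theorem toXDualR_neg (u : XDual X) : toXDualR (-u) = -toXDualR u := map_neg _ _

theorem dualXR_ext {W : Type*} [AddCommGroup W] [Module ℝ W] {f g : XR X →ₗ[ℝ] W}
    (h : ∀ x, f (toXR x) = g (toXR x)) : f = g := by
  ext x
  exact h x

theorem exists_eq_sum_toXR {ι : Type*} [Fintype ι] (m : Module.Basis ι ℤ X) (z : XR X) :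
    ∃ c : ι → ℝ, z = ∑ i, c i • toXR (m i) := by
  refine ⟨(Algebra.TensorProduct.basis ℝ m).repr z, ?_⟩
  conv_lhs => rw [← (Algebra.TensorProduct.basis ℝ m).sum_repr z]
  simp [toXR]

theorem finite_dual_of_bounded {ι : Type*} [Finite ι] (m : Module.Basis ι ℤ X)
    {S : Set (XDual X)} (lo hi : ι → ℝ) (h : ∀ u ∈ S, ∀ i, lo i ≤ u (m i) ∧ (u (m i) : ℝ) ≤ hi i) :
    S.Finite := by
  classical
  have := Fintype.ofFinite ι
  refine ((Set.finite_Icc (fun i => ⌊lo i⌋) (fun i => ⌈hi i⌉)).preimage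
    (f := fun u : XDual X => fun i => u (m i)) ?_).subset fun u hu => ⟨fun i => ?_, fun i => ?_⟩
  · intro u _ u' _ huu
    exact m.ext fun i => congrFun huu i
  · exact_mod_cast (Int.floor_le _).trans (h u hu i).1
  · exact_mod_cast (h u hu i).2.trans (Int.le_ceil _)

theorem finite_of_bounded {ι : Type*} [Finite ι] (m : Module.Basis ι ℤ X)
    {S : Set X} (lo hi : ι → ℤ) (h : ∀ x ∈ S, ∀ i, lo i ≤ m.coord i x ∧ m.coord i x ≤ hi i) :
    S.Finite := by
  classical
  have := Fintype.ofFinite ι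
  refine ((Set.finite_Icc lo hi).preimage
    (f := fun x : X => fun i => m.coord i x) ?_).subset
      fun x hx => ⟨fun i => (h x hx i).1, fun i => (h x hx i).2⟩
  intro x _ y _ hxy
  exact m.ext_elem fun i => congrFun hxy i

end Lattice

theorem tendsto_floor_mul_natCast_div (c : ℝ) :
    Filter.Tendsto (fun n : ℕ => (⌊c * n⌋ : ℝ) / n) Filter.atTop (nhds c) := by
  have h1 : Filter.Tendsto (fun n : ℕ => c - 1 / (n : ℝ)) Filter.atTop (nhds c) := by
    simpa using tendsto_const_nhds.sub (tendsto_one_div_atTop_nhds_zero_nat (𝕜 := ℝ))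
  refine tendsto_of_tendsto_of_tendsto_of_le_of_le' h1 tendsto_const_nhds ?_ ?_
  · filter_upwards [Filter.eventually_gt_atTop 0] with n hn
    have hn : (0 : ℝ) < n := by exact_mod_cast hn
    rw [le_div_iff₀ hn, sub_mul, one_div_mul_cancel hn.ne']
    exact (Int.sub_one_lt_floor _).le
  · filter_upwards [Filter.eventually_gt_atTop 0] with n hn
    have hn : (0 : ℝ) < n := by exact_mod_cast hn
    rw [div_le_iff₀ hn]
    exact Int.floor_le _

section Form

variable {R K X : Type*} [CommRing R] [IsDomain R] [IsDiscreteValuationRing R]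
  [Field K] [Algebra R K] [IsFractionRing R K] [AddCommGroup X]

namespace FCDatum

variable (ξ : FCDatum R K X)

theorem idx_pos : 0 < ξ.idx :=
  Nat.pos_of_ne_zero ξ.finiteIndex.index_ne_zero

theorem coe_mulIdx (x : X) : (ξ.mulIdx x : X) = ξ.idx • x := rfl

theorem mulIdx_coe (y : ξ.Y) : ξ.mulIdx (y : X) = ξ.idx • y := rfl

theorem B_symm (y z : ξ.Y) : ξ.B y (z : X) = ξ.B z (y : X) := ξ.symm y z

theorem B_pos (y : ξ.Y) (hy : y ≠ 0) : 0 < ξ.B y (y : X) := ξ.pos y hy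

theorem BR_toXR (x x' : X) :
    ξ.BR (toXR x) (toXR x') = (ξ.idx : ℝ)⁻¹ * (ξ.B (ξ.mulIdx x) x' : ℤ) := by
  simp [BR, toXR]

theorem BR_coe_toXR (y : ξ.Y) (x : X) : ξ.BR (toXR (y : X)) (toXR x) = (ξ.B y x : ℤ) := by
  have h : (ξ.idx : ℝ) ≠ 0 := by exact_mod_cast ξ.idx_pos.ne'
  rw [BR_toXR, mulIdx_coe, map_nsmul, LinearMap.smul_apply]
  simp [h]

theorem BR_symm (z w : XR X) : ξ.BR z w = ξ.BR w z := by
  suffices h : ξ.BR = ξ.BR.flip by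
    conv_lhs => rw [h]
    rfl
  refine dualXR_ext fun x => dualXR_ext fun x' => ?_
  change _ = ξ.BR (toXR x') (toXR x)
  rw [BR_toXR, BR_toXR]
  have hpos := ξ.idx_pos
  have h := ξ.B_symm (ξ.mulIdx x) (ξ.mulIdx x')
  rw [coe_mulIdx, coe_mulIdx, map_nsmul, map_nsmul] at h
  rw [smul_right_injective ℤ hpos.ne' h]

theorem BR_toXR_self_nonneg (x : X) : 0 ≤ ξ.BR (toXR x) (toXR x) := by
  rw [BR_toXR]
  have hB : 0 ≤ ξ.B (ξ.mulIdx x) (ξ.mulIdx x : X) := by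
    by_cases h : ξ.mulIdx x = 0
    · simp [h]
    · exact (ξ.B_pos _ h).le
  rw [coe_mulIdx, map_nsmul, nsmul_eq_mul] at hB
  have h := nonneg_of_mul_nonneg_right hB (by exact_mod_cast ξ.idx_pos)
  have h' : (0 : ℝ) ≤ (ξ.B (ξ.mulIdx x) x : ℤ) := by exact_mod_cast h
  positivity

/-- The real extension of `B` is positive semidefinite, since a real vector is a limit of vectors
`x / n` with `x ∈ X`. -/
theorem BR_self_nonneg [Module.Free ℤ X] [Module.Finite ℤ X] (z : XR X) : 0 ≤ ξ.BR z z := by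
  let m := Module.Free.chooseBasis ℤ X
  obtain ⟨c, rfl⟩ := exists_eq_sum_toXR m z
  have hexp : ∀ d : Module.Free.ChooseBasisIndex ℤ X → ℝ,
      ξ.BR (∑ i, d i • toXR (m i)) (∑ i, d i • toXR (m i)) =
        ∑ i, ∑ j, d i * (d j * ξ.BR (toXR (m i)) (toXR (m j))) := by
    intro d
    simp only [map_sum, map_smul, LinearMap.sum_apply, LinearMap.smul_apply, smul_eq_mul,
      Finset.mul_sum]
    rw [Finset.sum_comm]
    exact Finset.sum_congr rfl fun i _ => Finset.sum_congr rfl fun j _ => by ring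
  rw [hexp]
  have hlim : Filter.Tendsto (fun n : ℕ => ∑ i, ∑ j,
      ((⌊c i * n⌋ : ℝ) / n) * (((⌊c j * n⌋ : ℝ) / n) * ξ.BR (toXR (m i)) (toXR (m j))))
      Filter.atTop (nhds (∑ i, ∑ j, c i * (c j * ξ.BR (toXR (m i)) (toXR (m j))))) :=
    tendsto_finsetSum _ fun i _ => tendsto_finsetSum _ fun j _ =>
      (tendsto_floor_mul_natCast_div (c i)).mul
        ((tendsto_floor_mul_natCast_div (c j)).mul_const _)
  refine ge_of_tendsto' hlim fun n => ?_
  rw [← hexp fun i => (⌊c i * n⌋ : ℝ) / n]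
  have hsum : ∑ i, ((⌊c i * n⌋ : ℝ) / n) • toXR (m i) =
      (n : ℝ)⁻¹ • toXR (∑ i, ⌊c i * n⌋ • m i) := by
    simp only [toXR, TensorProduct.tmul_sum, Finset.smul_sum]
    refine Finset.sum_congr rfl fun i _ => ?_
    have h := toXR_zsmul ⌊c i * n⌋ (m i)
    simp only [toXR] at h
    rw [h, smul_smul, div_eq_inv_mul]
  rw [hsum]
  simp only [map_smul, LinearMap.smul_apply, smul_eq_mul]
  have h := ξ.BR_toXR_self_nonneg (∑ i, ⌊c i * n⌋ • m i)
  positivity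

theorem finrank_Y [Module.Free ℤ X] [Module.Finite ℤ X] :
    Module.finrank ℤ ξ.Y = Module.finrank ℤ X := by
  refine le_antisymm ξ.Y.finrank_le (LinearMap.finrank_le_finrank_of_injective (f := ξ.mulIdx) ?_)
  intro x x' h
  have h' := congrArg (fun y : ξ.Y => (y : X)) h
  simp only [coe_mulIdx, ← natCast_zsmul] at h'
  exact smul_right_injective X (Int.natCast_ne_zero.2 ξ.idx_pos.ne') h'

theorem β_injective : Function.Injective ξ.β := by
  rw [injective_iff_map_eq_zero]
  intro y hy
  by_contra hne
  have h := ξ.B_pos y hne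
  have h0 : ξ.B y (y : X) = 0 := by
    change ξ.β y (y : X) = 0
    simp [hy]
  omega

/-- `β(Y)` has finite index in `X^∨`, both being free of rank `g`. -/
theorem N_pos [Module.Free ℤ X] [Module.Finite ℤ X] : 0 < ξ.N := by
  have : Finite (XDual X ⧸ LinearMap.range ξ.β) := by
    have h : Module.finrank ℤ (LinearMap.range ξ.β) = Module.finrank ℤ (XDual X) := by
      rw [LinearMap.finrank_range_of_inj ξ.β_injective, finrank_Y, Module.finrank_linearMap_self]
    exact Submodule.finiteQuotientOfFreeOfRankEq _ h
  exact Nat.card_pos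

end FCDatum

end Form

/-! ### Voronoi cells as regions of linearity -/

section Voronoi

variable {R K X : Type*} [CommRing R] [IsDomain R] [IsDiscreteValuationRing R]
  [Field K] [Algebra R K] [IsFractionRing R K] [AddCommGroup X]

namespace NFCDatum

variable {ξ : ExtFCDatum R K X} (ζ : NFCDatum ξ) (l : ℕ)

theorem shift_add (u w : XDual X) : ζ.shift l (u + w) = ζ.shift l u + ζ.shift l w := by
  simp [shift]

theorem shift_sub (u w : XDual X) : ζ.shift l (u - w) = ζ.shift l u - ζ.shift l w := by
  simp [shift, smul_sub]

theorem shift_zero : ζ.shift l 0 = 0 := by simp [shift]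

theorem apply_shift_self (u : XDual X) : u (ζ.shift l u) = 2 * ζ.El l u := by
  rw [shift, El, ζ.E_eq, map_nsmul]
  simp
  ring

theorem El_neg (u : XDual X) : ζ.El l (-u) = ζ.El l u := by
  simp [El, ζ.E_eq]

theorem El_zero : ζ.El l 0 = 0 := by
  simp [El, ζ.E_eq]

/-- `2lφ(u)` represents the functional `2lN u` under the form `B`. -/
theorem BR_shift (u : XDual X) (z : XR X) :
    ξ.BR (toXR (ζ.shift l u)) z = 2 * l * ξ.N * toXDualR u z := by
  suffices h : ξ.BR (toXR (ζ.shift l u)) = (2 * l * ξ.N : ℝ) • toXDualR u by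
    rw [h]
    rfl
  refine dualXR_ext fun x => ?_
  have hφ : (ξ.N : ℝ) * u x = (ξ.B (ζ.φ u) x : ℤ) := by exact_mod_cast ζ.φ_eq u x
  rw [shift, toXR_nsmul, map_smul, LinearMap.smul_apply, LinearMap.smul_apply, toXDualR_toXR,
    ξ.BR_coe_toXR, ← hφ]
  push_cast
  simp only [smul_eq_mul]
  ring

/-- Completing the square: `‖z - 2lφ(u)‖² = ‖z‖² - 4lN (u(z) - E_l(u))`. -/
theorem BR_sub_shift_self (u : XDual X) (z : XR X) :
    ξ.BR (z - toXR (ζ.shift l u)) (z - toXR (ζ.shift l u)) =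
      ξ.BR z z - 4 * l * ξ.N * (toXDualR u z - ζ.El l u) := by
  have h2 : toXDualR u (toXR (ζ.shift l u)) = 2 * (ζ.El l u : ℝ) := by
    rw [toXDualR_toXR, apply_shift_self]
    push_cast
    ring
  simp only [map_sub, LinearMap.sub_apply]
  rw [ξ.BR_symm z (toXR _), BR_shift, BR_shift, h2]
  ring

variable {l}

theorem shift_mem_voronoi (u : XDual X) : toXR (ζ.shift l u) ∈ ζ.voronoi l u := by
  intro w
  rw [sub_self]
  simp [FCDatum.nrm]

theorem sub_shift_mem_voronoi {x : XR X} {c : XDual X} (u : XDual X)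
    (h : x ∈ ζ.voronoi l c) : x - toXR (ζ.shift l u) ∈ ζ.voronoi l (c - u) := by
  intro w
  have h1 := h (w + u)
  rw [shift_add, toXR_add] at h1
  rw [shift_sub, toXR_sub]
  convert h1 using 2 <;> abel

variable [Module.Free ℤ X] [Module.Finite ℤ X]

/-- The cell `Σ_l(c)` is the region where the affine function `c - E_l(c)` is the largest. -/
theorem mem_voronoi (hl : 0 < l) {c : XDual X} {x : XR X} :
    x ∈ ζ.voronoi l c ↔
      ∀ u, toXDualR u x - ζ.El l u ≤ toXDualR c x - (ζ.El l c : ℝ) := by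
  refine forall_congr' fun u => ?_
  have hl' : (0 : ℝ) < l := by exact_mod_cast hl
  have hN : (0 : ℝ) < ξ.N := by exact_mod_cast ξ.N_pos
  have hpos : (0 : ℝ) < 4 * l * ξ.N := by positivity
  rw [FCDatum.nrm, FCDatum.nrm, Real.sqrt_le_sqrt_iff (ξ.BR_self_nonneg _), BR_sub_shift_self,
    BR_sub_shift_self, sub_le_sub_iff_left, mul_le_mul_iff_right₀ hpos]

theorem finite_superlevel (hl : 0 < l) (x : XR X) (C : ℝ) :
    {u : XDual X | C ≤ toXDualR u x - (ζ.El l u : ℝ)}.Finite := by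
  have hl' : (0 : ℝ) < l := by exact_mod_cast hl
  have hN : (0 : ℝ) < ξ.N := by exact_mod_cast ξ.N_pos
  have hpos : (0 : ℝ) < 4 * l * ξ.N := by positivity
  -- The affine functions `u - E_l(u)` have a common upper bound at every point; it is applied
  -- at the points obtained from `x` by adding or subtracting a basis vector.
  have hbound : ∀ (y : XR X) (u : XDual X),
      toXDualR u y - ζ.El l u ≤ ξ.BR y y / (4 * l * ξ.N) := fun y u => by
    rw [le_div_iff₀ hpos]
    have h1 := ξ.BR_self_nonneg (y - toXR (ζ.shift l u))
    rw [BR_sub_shift_self] at h1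
    linarith
  let m := Module.Free.chooseBasis ℤ X
  refine finite_dual_of_bounded m
    (fun i => C - ξ.BR (x - toXR (m i)) (x - toXR (m i)) / (4 * l * ξ.N))
    (fun i => ξ.BR (x + toXR (m i)) (x + toXR (m i)) / (4 * l * ξ.N) - C) fun u hu i => ?_
  have hu : C ≤ toXDualR u x - (ζ.El l u : ℝ) := hu
  have h1 := hbound (x + toXR (m i)) u
  have h2 := hbound (x - toXR (m i)) u
  rw [map_add, toXDualR_toXR] at h1
  rw [map_sub, toXDualR_toXR] at h2
  constructor <;> linarith

theorem exists_mem_voronoi (hl : 0 < l) (x : XR X) : ∃ u, x ∈ ζ.voronoi l u := by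
  obtain ⟨u, hu⟩ := exists_forall_le_of_finite_superlevel ⟨0⟩ _ (ζ.finite_superlevel hl x)
  exact ⟨u, (ζ.mem_voronoi hl).2 hu⟩

theorem toXR_mem_voronoi_zero (hl : 0 < l) {α : X} :
    toXR α ∈ ζ.voronoi l 0 ↔ α ∈ ζ.SigL l := by
  rw [ζ.mem_voronoi hl]
  simp only [toXDualR_toXR, El_zero]
  constructor
  · intro h u
    have h1 := h (-u)
    rw [El_neg, LinearMap.neg_apply] at h1
    push_cast at h1
    have h2 : (0 : ℝ) ≤ (ζ.El l u + u α : ℤ) := by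
      push_cast
      simp at h1
      linarith
    exact_mod_cast h2
  · intro h u
    have h1 := h (-u)
    rw [El_neg, LinearMap.neg_apply] at h1
    have h2 : (0 : ℝ) ≤ (ζ.El l u + -u α : ℤ) := by exact_mod_cast h1
    push_cast at h2
    simp
    linarith

theorem sub_shift_mem_SigL (hl : 0 < l) {x : X} {u : XDual X} :
    x - ζ.shift l u ∈ ζ.SigL l ↔ toXR x ∈ ζ.voronoi l u := by
  rw [← ζ.toXR_mem_voronoi_zero hl, toXR_sub]
  constructor
  · intro h
    have h1 := ζ.sub_shift_mem_voronoi (-u) h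
    have h2 : toXR (ζ.shift l (-u)) = -toXR (ζ.shift l u) := by
      rw [← zero_sub u, shift_sub, shift_zero, toXR_sub]
      simp [toXR]
    rwa [h2, zero_sub, neg_neg, sub_neg_eq_add, sub_add_cancel] at h1
  · intro h
    have h1 := ζ.sub_shift_mem_voronoi u h
    rwa [sub_self] at h1

/-- `D_l` is the restriction to `X` of the maximum of the affine functions `u - E_l(u)`. -/
theorem D_eq (hl : 0 < l) {x : X} {u : XDual X} (h : toXR x ∈ ζ.voronoi l u) :
    ζ.D l x = u x - ζ.El l u := by
  have hex : ∃ z : XDual X, x - ζ.shift l z ∈ ζ.SigL l := ⟨u, (ζ.sub_shift_mem_SigL hl).2 h⟩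
  have hval : ζ.D l x = hex.choose x - ζ.El l hex.choose := by
    rw [D, dif_pos hex, map_sub, apply_shift_self]
    ring
  rw [hval]
  have h1 := (ζ.mem_voronoi hl).1 ((ζ.sub_shift_mem_SigL hl).1 hex.choose_spec) u
  have h2 := (ζ.mem_voronoi hl).1 h hex.choose
  rw [toXDualR_toXR, toXDualR_toXR] at h1 h2
  have h3 := le_antisymm h1 h2
  exact_mod_cast h3.symm

theorem finite_SigL : (ζ.SigL l).Finite := by
  let m := Module.Free.chooseBasis ℤ X
  refine finite_of_bounded m (fun i => -ζ.El l (m.coord i)) (fun i => ζ.El l (m.coord i))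
    fun x hx i => ?_
  have h1 := hx (m.coord i)
  have h2 := hx (-m.coord i)
  rw [El_neg, LinearMap.neg_apply] at h2
  constructor <;> linarith

theorem inc_iff (hl : 0 < l) (u : XDual X) (x : X) :
    toXDualR u (toXR x) = (ζ.D l x : ℝ) + ζ.El l u ↔ toXR x ∈ ζ.voronoi l u := by
  constructor
  · intro h
    obtain ⟨c, hc⟩ := ζ.exists_mem_voronoi hl (toXR x)
    have h1 : (ζ.D l x : ℝ) = c x - ζ.El l c := by exact_mod_cast ζ.D_eq hl hc
    rw [ζ.mem_voronoi hl] at hc ⊢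
    intro w
    rw [h, h1]
    have := hc w
    rw [toXDualR_toXR] at this ⊢
    rw [toXDualR_toXR] at this
    linarith
  · intro h
    have h1 : (ζ.D l x : ℝ) = u x - ζ.El l u := by exact_mod_cast ζ.D_eq hl h
    rw [toXDualR_toXR, h1]
    ring

/-- The tiling of `X_ℝ` by the Voronoi cells, as the tiling of a piecewise linear function that
extends `D_l`. -/
def tiling (hl : 0 < l) (hint : IsIntegralPolytope (ζ.voronoi l 0)) :
    PLTiling (XR X) X (XDual X) where
  pt := toXR
  lin := toXDualR
  D x := ζ.D l x
  e u := ζ.El l u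
  lin_le u x := by
    obtain ⟨c, hc⟩ := ζ.exists_mem_voronoi hl (toXR x)
    have h1 : (ζ.D l x : ℝ) = c x - ζ.El l c := by exact_mod_cast ζ.D_eq hl hc
    have h2 := (ζ.mem_voronoi hl).1 hc u
    rw [toXDualR_toXR c] at h2
    linarith
  exists_lin x := by
    obtain ⟨c, hc⟩ := ζ.exists_mem_voronoi hl (toXR x)
    exact ⟨c, (ζ.inc_iff hl c x).2 hc⟩
  exists_pt u := ⟨ζ.shift l u, (ζ.inc_iff hl _ _).2 (ζ.shift_mem_voronoi u)⟩
  subset_convexHull u := by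
    intro x hx
    have hx0 := ζ.sub_shift_mem_voronoi u ((ζ.mem_voronoi hl).2 hx)
    rw [sub_self, hint.eq_conv] at hx0
    set C := convexHull ℝ (toXR '' {x | toXDualR u (toXR x) = (ζ.D l x : ℝ) + ζ.El l u})
    have hsub : convexHull ℝ (ζ.voronoi l 0 ∩ Set.range toXR) ⊆
        (fun w => toXR (ζ.shift l u) + w) ⁻¹' C := by
      refine convexHull_min ?_ ((convex_convexHull ℝ _).translate_preimage_right _)
      rintro _ ⟨hα, α, rfl⟩
      refine subset_convexHull ℝ _ ⟨ζ.shift l u + α, (ζ.inc_iff hl _ _).2 ?_, toXR_add _ _⟩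
      rw [← ζ.sub_shift_mem_SigL hl, add_sub_cancel_left]
      exact (ζ.toXR_mem_voronoi_zero hl).1 hα
    have h := hsub hx0
    rwa [Set.mem_preimage, add_sub_cancel] at h
  finite_pt u := by
    refine ((ζ.finite_SigL (l := l)).preimage (f := fun x => x - ζ.shift l u)
      (sub_left_injective.injOn)).subset fun x hx => ?_
    exact (ζ.sub_shift_mem_SigL hl).2 ((ζ.inc_iff hl u x).1 hx)
  finite_lin x C := ζ.finite_superlevel hl x C

end NFCDatum

end Voronoi

/-! ### Cones over dual cells -/

section Cone

variable {X : Type*} [AddCommGroup X]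

/-- The cone consisting of `0` and all `x₀ (f₀ - w)` with `x₀ > 0` and `w ∈ G`. The sign is there
because `Cut(τ_{l,a})` is the negative of a subdifferential. -/
def coneOver (G : Set (XDualR X)) : Set (ℝ × XDualR X) :=
  {z | z = 0 ∨ 0 < z.1 ∧ -(z.1⁻¹ • z.2) ∈ G}

theorem cut_coneOver (G : Set (XDualR X)) : Cut (coneOver G) = {z | -z ∈ G} := by
  ext z
  simp [Cut, coneOver]

theorem coneOver_mono {G G' : Set (XDualR X)} (h : G ⊆ G') : coneOver G ⊆ coneOver G' :=
  fun _ hz => hz.imp_right fun hz => ⟨hz.1, h hz.2⟩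

theorem forall_mem_coneOver {ι : Type*} {S : Set ι} (hS : S.Nonempty) (G : ι → Set (XDualR X)) :
    {z | ∀ i ∈ S, z ∈ coneOver (G i)} = coneOver {w | ∀ i ∈ S, w ∈ G i} := by
  obtain ⟨i, hi⟩ := hS
  ext z
  constructor
  · intro h
    by_cases hz : z = 0
    · exact Or.inl hz
    · exact Or.inr ⟨((h i hi).resolve_left hz).1, fun j hj => ((h j hj).resolve_left hz).2⟩
  · rintro (h | ⟨h, h'⟩) j hj
    · exact Or.inl h
    · exact Or.inr ⟨h, h' j hj⟩

theorem setOf_neg_mem_subset_iff {W : Type*} [AddCommGroup W] {G G' : Set W} :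
    {z | -z ∈ G} ⊆ {z | -z ∈ G'} ↔ G ⊆ G' := by
  refine ⟨fun h w hw => ?_, fun h z hz => h hz⟩
  have h1 : -w ∈ {z | -z ∈ G} := by simpa using hw
  simpa using h h1

theorem vectorSpan_setOf_neg_mem {W : Type*} [AddCommGroup W] [Module ℝ W] (G : Set W) :
    vectorSpan ℝ {z | -z ∈ G} = vectorSpan ℝ G := by
  rw [vectorSpan_def, vectorSpan_def]
  congr 1
  ext w
  constructor
  · rintro ⟨x, hx, y, hy, rfl⟩
    exact ⟨-y, hy, -x, hx, by simp; abel⟩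
  · rintro ⟨x, hx, y, hy, rfl⟩
    exact ⟨-y, by simpa using hy, -x, by simpa using hx, by simp; abel⟩

end Cone

/-! ### The fan and the Voronoi decomposition -/

section Fan

variable {R K X : Type*} [CommRing R] [IsDomain R] [IsDiscreteValuationRing R]
  [Field K] [Algebra R K] [IsFractionRing R K] [AddCommGroup X]
  [Module.Free ℤ X] [Module.Finite ℤ X]

namespace NFCDatum

variable {ξ : ExtFCDatum R K X} (ζ : NFCDatum ξ) {l : ℕ} (hl : 0 < l)
  (hint : IsIntegralPolytope (ζ.voronoi l 0))

theorem tiling_cell (c : XDual X) : (ζ.tiling hl hint).cell c = ζ.voronoi l c := by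
  ext x
  exact (ζ.mem_voronoi hl).symm

/-- `τ_{l,a}` is the cone over the dual cell of `a`. -/
theorem tau_eq (a : X) : ζ.tau l a = coneOver ((ζ.tiling hl hint).dualCell a) := by
  ext ⟨r, w⟩
  constructor
  · rintro ⟨hr, h⟩
    simp only at hr h
    rcases hr.eq_or_lt with rfl | hr
    · left
      have hw : w = 0 := by
        refine dualXR_ext fun x => ?_
        have h1 := h (a + x)
        have h2 := h (a - x)
        rw [mul_zero, zero_add, add_sub_cancel_left] at h1
        rw [mul_zero, zero_add, sub_sub_cancel_left] at h2
        have h3 : toXR (-x) = -toXR x := TensorProduct.tmul_neg _ _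
        rw [h3, map_neg] at h2
        rw [LinearMap.zero_apply]
        linarith
      rw [hw]
      rfl
    · refine Or.inr ⟨hr, fun y => ?_⟩
      have h1 := h y
      rw [toXR_sub, map_sub] at h1
      push_cast at h1
      change (-(r⁻¹ • w)) (toXR y) - (ζ.D l y : ℝ) ≤ (-(r⁻¹ • w)) (toXR a) - (ζ.D l a : ℝ)
      simp only [LinearMap.neg_apply, LinearMap.smul_apply, smul_eq_mul]
      have h2 : 0 ≤ r⁻¹ * (((ζ.D l y : ℝ) - ζ.D l a) * r + (w (toXR y) - w (toXR a))) := by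
        positivity
      have h3 : r⁻¹ * (((ζ.D l y : ℝ) - ζ.D l a) * r + (w (toXR y) - w (toXR a))) =
          ((ζ.D l y : ℝ) - ζ.D l a) + (r⁻¹ * w (toXR y) - r⁻¹ * w (toXR a)) := by
        field_simp
      linarith
  · rintro (h | ⟨hr, h⟩)
    · rw [h]
      exact ⟨le_rfl, fun y => by simp⟩
    · simp only at hr h
      refine ⟨hr.le, fun y => ?_⟩
      have h1 : (-(r⁻¹ • w)) (toXR y) - (ζ.D l y : ℝ) ≤ (-(r⁻¹ • w)) (toXR a) - (ζ.D l a : ℝ) :=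
        h y
      simp only [LinearMap.neg_apply, LinearMap.smul_apply, smul_eq_mul] at h1
      rw [toXR_sub, map_sub]
      push_cast
      have h3 : ((ζ.D l y : ℝ) - ζ.D l a) * r + (w (toXR y) - w (toXR a)) =
          r * (((ζ.D l y : ℝ) - ζ.D l a) + (r⁻¹ * w (toXR y) - r⁻¹ * w (toXR a))) := by
        field_simp
      rw [h3]
      exact mul_nonneg hr.le (by linarith)

/-- The Voronoi decomposition is indexed by the pairs of the tiling. -/
theorem mem_Vor_iff {Δ : Set (XR X)} : Δ ∈ ζ.Vor l ↔
    ∃ A B, (ζ.tiling hl hint).IsPair A B ∧ Δ = convexHull ℝ (toXR '' A) := by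
  have h := (ζ.tiling hl hint).isFace_cell_iff (F := Δ)
  simp only [tiling_cell] at h
  exact h

variable {hl hint}

variable {A : Set X} {B : Set (XDual X)}

theorem setOf_forall_mem_tau (h : (ζ.tiling hl hint).IsPair A B) :
    {z | ∀ a ∈ A, z ∈ ζ.tau l a} = coneOver (convexHull ℝ (toXDualR '' B)) := by
  simp only [ζ.tau_eq hl hint]
  rw [forall_mem_coneOver h.nonempty_left]
  exact congrArg coneOver h.convexHull_right.symm

theorem tauFace_eq (h : (ζ.tiling hl hint).IsPair A B) :
    ζ.tauFace l (convexHull ℝ (toXR '' A)) = coneOver (convexHull ℝ (toXDualR '' B)) := by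
  have h1 : ζ.tauFace l (convexHull ℝ (toXR '' A)) =
      {z | ∀ a ∈ {a | toXR a ∈ vertices (convexHull ℝ (toXR '' A))}, z ∈ ζ.tau l a} := by
    ext z
    simp [tauFace]
  rw [h1]
  simp only [ζ.tau_eq hl hint]
  rw [forall_mem_coneOver (S := {a | toXR a ∈ vertices (convexHull ℝ (toXR '' A))})
    h.exists_vertex_left]
  exact congrArg coneOver h.iInter_dualCell_vertices

theorem deltaOf_eq (h : (ζ.tiling hl hint).IsPair A B) :
    ζ.deltaOf l (coneOver (convexHull ℝ (toXDualR '' B))) = convexHull ℝ (toXR '' A) := by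
  have h2 := h.iInter_cell_vertices
  simp only [tiling_cell] at h2
  refine Eq.trans ?_ h2
  ext x
  simp only [deltaOf, Set.mem_iInter, cut_coneOver, neg_mem_vertices_neg]
  rfl

/-- The cone of a pair `(A, B)` is the face of `τ_{l,a₀}`, `a₀ ∈ A`, on which all the inequalities
given by the points of `A` are equalities. -/
theorem coneOver_mem_FanX (h : (ζ.tiling hl hint).IsPair A B) :
    coneOver (convexHull ℝ (toXDualR '' B)) ∈ ζ.FanX l := by
  obtain ⟨a₀, ha₀⟩ := h.nonempty_left
  obtain ⟨u₀, hu₀⟩ := h.nonempty_right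
  constructor
  · obtain ⟨c, hc⟩ := ζ.exists_mem_voronoi hl (toXR a₀)
    refine ⟨a₀ - ζ.shift l c, (ζ.sub_shift_mem_SigL hl).2 hc, c, ?_⟩
    rw [sub_add_cancel]
    -- The dual vector is the sum of the linear inequalities for the points of `A`.
    have key : ∀ z : ℝ × XDualR X,
        z.1 * (∑ a ∈ h.finite_left.toFinset, ((ζ.D l a - ζ.D l a₀ : ℤ) : ℝ)) +
          z.2 (∑ a ∈ h.finite_left.toFinset, toXR (a - a₀)) =
        ∑ a ∈ h.finite_left.toFinset,
          (((ζ.D l a - ζ.D l a₀ : ℤ) : ℝ) * z.1 + z.2 (toXR (a - a₀))) := by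
      intro z
      rw [Finset.sum_add_distrib, map_sum, Finset.mul_sum]
      simp only [mul_comm]
    refine ⟨∑ a ∈ h.finite_left.toFinset, ((ζ.D l a - ζ.D l a₀ : ℤ) : ℝ),
      ∑ a ∈ h.finite_left.toFinset, toXR (a - a₀), fun z hz => ?_, ?_⟩
    · rw [key]
      exact Finset.sum_nonneg fun a _ => hz.2 a
    · rw [← ζ.setOf_forall_mem_tau h]
      ext z
      rw [Set.mem_ofPred_eq, Set.mem_ofPred_eq, key]
      constructor
      · intro hz
        refine ⟨hz a₀ ha₀, Finset.sum_eq_zero fun a ha => le_antisymm ?_ ((hz a₀ ha₀).2 a)⟩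
        have h1 := (hz a (h.finite_left.mem_toFinset.1 ha)).2 a₀
        rw [toXR_sub, map_sub] at h1 ⊢
        push_cast at h1 ⊢
        linarith
      · rintro ⟨hz, hsum⟩ a ha
        have h1 := (Finset.sum_eq_zero_iff_of_nonneg fun a _ => hz.2 a).1 hsum a
          (h.finite_left.mem_toFinset.2 ha)
        refine ⟨hz.1, fun y => ?_⟩
        have h2 := hz.2 y
        rw [toXR_sub, map_sub] at h1 h2 ⊢
        push_cast at h1 h2 ⊢
        linarith
  · intro h0
    have h1 : ((1 : ℝ), -toXDualR u₀) ∈ coneOver (convexHull ℝ (toXDualR '' B)) := by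
      refine Or.inr ⟨one_pos, ?_⟩
      simp only [inv_one, one_smul, neg_neg]
      exact subset_convexHull ℝ _ ⟨u₀, hu₀, rfl⟩
    rw [Set.mem_singleton_iff.1 h0] at h1
    exact one_ne_zero (congrArg Prod.fst h1)

/-- The non-zero cones of the fan are the cones over the faces of the dual cells: the linear form
that cuts out the face of the cone cuts out a face of its slice at height one. -/
theorem mem_FanX_iff (hl : 0 < l) (hint : IsIntegralPolytope (ζ.voronoi l 0))
    {τ : Set (ℝ × XDualR X)} : τ ∈ ζ.FanX l ↔
    ∃ A B, (ζ.tiling hl hint).IsPair A B ∧ τ = coneOver (convexHull ℝ (toXDualR '' B)) := by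
  constructor
  · rintro ⟨⟨α, -, u, t, x, hpos, rfl⟩, hne⟩
    set a := α + ζ.shift l u
    rw [ζ.tau_eq hl hint] at hpos hne ⊢
    set G := (ζ.tiling hl hint).dualCell a
    have hle : ∀ w ∈ G, w x ≤ t := by
      intro w hw
      have h1 := hpos (1, -w) (Or.inr ⟨one_pos, by simpa using hw⟩)
      simp only [one_mul, LinearMap.neg_apply] at h1
      linarith
    have hset : {z | z ∈ coneOver G ∧ z.1 * t + z.2 x = 0} = coneOver {w | w ∈ G ∧ w x = t} := by
      ext z
      constructor
      · rintro ⟨h0 | ⟨h1, h2⟩, hz⟩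
        · exact Or.inl h0
        · refine Or.inr ⟨h1, h2, ?_⟩
          simp only [LinearMap.neg_apply, LinearMap.smul_apply, smul_eq_mul]
          field_simp
          linarith
      · rintro (rfl | ⟨h1, h2, h3⟩)
        · exact ⟨Or.inl rfl, by simp⟩
        · refine ⟨Or.inr ⟨h1, h2⟩, ?_⟩
          simp only [LinearMap.neg_apply, LinearMap.smul_apply, smul_eq_mul] at h3
          rw [← h3]
          field_simp
          ring
    rw [hset] at hne ⊢
    have hex : ∃ w ∈ G, w x = t := by
      by_contra hno
      push Not at hno
      refine hne (Set.eq_singleton_iff_unique_mem.2 ⟨Or.inl rfl, ?_⟩)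
      rintro z (hz | ⟨-, h1, h2⟩)
      · exact hz
      · exact absurd h2 (hno _ h1)
    obtain ⟨A, B, hAB, -, hG⟩ :=
      (ζ.tiling hl hint).exists_isPair_of_dualCell_face a x t hle hex
    exact ⟨A, B, hAB, congrArg coneOver hG⟩
  · rintro ⟨A, B, h, rfl⟩
    exact ζ.coneOver_mem_FanX h

end NFCDatum

end Fan
end NeronFC

end

theorem proposition7p19
    {R K X : Type*} [CommRing R] [IsDomain R] [IsDiscreteValuationRing R]
    [IsAdicComplete (IsLocalRing.maximalIdeal R) R]
    [Field K] [Algebra R K] [IsFractionRing R K]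
    [AddCommGroup X] [Module.Free ℤ X] [Module.Finite ℤ X]
    (ξ : NeronFC.ExtFCDatum R K X) (hξ : ξ.toFCDatum.IsExact) (ζ : NeronFC.NFCDatum ξ)
    (l : ℕ) (hl : 0 < l) (hint : NeronFC.IsIntegralPolytope (ζ.voronoi l 0)) :
    -- the constructions are meaningful: the vertices over which one intersects are lattice points,
    -- and the cones `τ_{l,Δ}` are non-zero cones of the fan
    ((∀ Δ ∈ ζ.Vor l, NeronFC.vertices Δ ⊆ Set.range NeronFC.toXR ∧ ζ.tauFace l Δ ∈ ζ.FanX l) ∧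
      ∀ τ ∈ ζ.FanX l, NeronFC.vertices (NeronFC.Cut τ) ⊆ Set.range NeronFC.toXDualR) ∧
    -- `Δ(τ)` is a Voronoi cell, and `τ` is recovered from it
    (∀ τ ∈ ζ.FanX l, ζ.deltaOf l τ ∈ ζ.Vor l ∧ τ = ζ.tauFace l (ζ.deltaOf l τ)) ∧
    -- `cut_l` is a bijection onto the set of cuts of the fan
    Set.BijOn (ζ.cut l) (ζ.Vor l) (NeronFC.Cut '' ζ.FanX l) ∧
    -- compatibility with inclusions
    (∀ σ ∈ ζ.FanX l, ∀ τ ∈ ζ.FanX l,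
      (σ ⊆ τ ↔ NeronFC.Cut σ ⊆ NeronFC.Cut τ) ∧
      (NeronFC.Cut σ ⊆ NeronFC.Cut τ ↔ ζ.deltaOf l τ ⊆ ζ.deltaOf l σ)) ∧
    -- complementary dimensions
    (∀ σ ∈ ζ.FanX l,
      NeronFC.polyDim (NeronFC.Cut σ) + NeronFC.polyDim (ζ.deltaOf l σ) =
        (Module.finrank ℤ X : ℤ)) := by
  refine ⟨⟨fun Δ hΔ => ?_, fun τ hτ => ?_⟩, fun τ hτ => ?_, ⟨fun Δ hΔ => ?_, fun Δ hΔ Δ' hΔ' heq => ?_,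
    ?_⟩, fun σ hσ τ hτ => ?_, fun σ hσ => ?_⟩
  · obtain ⟨A, B, h, rfl⟩ := (ζ.mem_Vor_iff hl hint).1 hΔ
    refine ⟨(NeronFC.vertices_convexHull_subset _).trans (Set.image_subset_range _ _), ?_⟩
    rw [ζ.tauFace_eq h]
    exact ζ.coneOver_mem_FanX h
  · obtain ⟨A, B, h, rfl⟩ := (ζ.mem_FanX_iff hl hint).1 hτ
    rw [NeronFC.cut_coneOver]
    intro z hz
    rw [← neg_neg z, NeronFC.neg_mem_vertices_neg] at hz
    obtain ⟨u, -, hu⟩ := NeronFC.vertices_convexHull_subset _ hz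
    exact ⟨-u, by rw [NeronFC.toXDualR_neg, hu, neg_neg]⟩
  · obtain ⟨A, B, h, rfl⟩ := (ζ.mem_FanX_iff hl hint).1 hτ
    rw [ζ.deltaOf_eq h, ζ.tauFace_eq h]
    exact ⟨(ζ.mem_Vor_iff hl hint).2 ⟨A, B, h, rfl⟩, rfl⟩
  · obtain ⟨A, B, h, rfl⟩ := (ζ.mem_Vor_iff hl hint).1 hΔ
    exact ⟨_, ζ.coneOver_mem_FanX h, by rw [NeronFC.NFCDatum.cut, ζ.tauFace_eq h]⟩
  · obtain ⟨A, B, h, rfl⟩ := (ζ.mem_Vor_iff hl hint).1 hΔ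
    obtain ⟨A', B', h', rfl⟩ := (ζ.mem_Vor_iff hl hint).1 hΔ'
    rw [NeronFC.NFCDatum.cut, NeronFC.NFCDatum.cut, ζ.tauFace_eq h, ζ.tauFace_eq h',
      NeronFC.cut_coneOver, NeronFC.cut_coneOver] at heq
    have hB := (h.convexHull_right_subset_iff h').1
      (NeronFC.setOf_neg_mem_subset_iff.1 heq.subset)
    have hB' := (h'.convexHull_right_subset_iff h).1
      (NeronFC.setOf_neg_mem_subset_iff.1 heq.symm.subset)
    rw [((h'.subset_iff h).1 hB').antisymm ((h.subset_iff h').1 hB)]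
  · rintro _ ⟨τ, hτ, rfl⟩
    obtain ⟨A, B, h, rfl⟩ := (ζ.mem_FanX_iff hl hint).1 hτ
    exact ⟨_, (ζ.mem_Vor_iff hl hint).2 ⟨A, B, h, rfl⟩,
      by rw [NeronFC.NFCDatum.cut, ζ.tauFace_eq h]⟩
  · obtain ⟨A, B, h, rfl⟩ := (ζ.mem_FanX_iff hl hint).1 hσ
    obtain ⟨A', B', h', rfl⟩ := (ζ.mem_FanX_iff hl hint).1 hτ
    rw [ζ.deltaOf_eq h, ζ.deltaOf_eq h', NeronFC.cut_coneOver, NeronFC.cut_coneOver,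
      NeronFC.setOf_neg_mem_subset_iff]
    refine ⟨⟨fun hsub => ?_, NeronFC.coneOver_mono⟩, ?_⟩
    · rw [← NeronFC.setOf_neg_mem_subset_iff, ← NeronFC.cut_coneOver, ← NeronFC.cut_coneOver]
      exact fun z hz => hsub hz
    · exact (h.convexHull_right_subset_iff h').trans
        ((h.subset_iff h').trans (h'.convexHull_left_subset_iff h).symm)
  · obtain ⟨A, B, h, rfl⟩ := (ζ.mem_FanX_iff hl hint).1 hσ
    have hG : {z : NeronFC.XDualR X | -z ∈ convexHull ℝ (NeronFC.toXDualR '' B)} ≠ ∅ := by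
      obtain ⟨u, hu⟩ := h.nonempty_right
      refine Set.Nonempty.ne_empty ⟨-NeronFC.toXDualR u, ?_⟩
      rw [Set.mem_ofPred_eq, neg_neg]
      exact subset_convexHull ℝ _ ⟨u, hu, rfl⟩
    have hF : convexHull ℝ (NeronFC.toXR '' A) ≠ ∅ := (h.nonempty_left.image _).convexHull.ne_empty
    rw [ζ.deltaOf_eq h, NeronFC.cut_coneOver, NeronFC.polyDim, NeronFC.polyDim, if_neg hG,
      if_neg hF, NeronFC.vectorSpan_setOf_neg_mem, ← Module.finrank_baseChange (R := ℝ) (S := ℤ)]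
    exact_mod_cast h.finrank_vectorSpan_add
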